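/- Let $d\ge 1$, $D=[0,1]^d$, let $\|\cdot\|$ be the Euclidean norm on $\mathbb{R}^d$, and let $\mu$ be the isotropic Wiener measure (Lévy's Brownian motion) on $C(D)$, i.e. the zero-mean Gaussian Borel measure with covariance $\int f(x)f(y)\,\mu(df)=\frac{\|x\|+\|y\|-\|x-y\|}{2}$ for $x,y\in D$. Consider the integration problem $\mathrm{Int}(f)=\int_D f(x)\,dx\in G=\mathbb{R}$ and the approximation problem $\mathrm{App}(f)=f\in G=L_2(D)$. A randomized adaptive method draws a random outcome $t$ (independent of $f$) from a probability space, then computes finitely many values $f(x_1),\dots,f(x_{n_t(f)})$, where each point $x_i$ and the decision to stop may depend on $t$ and on the values computed before, and returns $U_t(f)\in G$, an arbitrary function of $t$ and of the computed values (measurability being required only of $n_t(f)$ and of the error $\|S(f)-U_t(f)\|_G$, as functions of $(f,t)$). For $S\in\{\mathrm{Int},\mathrm{App}\}$ its average error is $\left(E_\mu E_t\|S(f)-U_t(f)\|_G^2\right)^{1/2}$ and its average cost is $E_\mu E_t\,n_t(f)$. The average-case complexity $\mathrm{comp}(\varepsilon,S)$ is the infimum of the average costs of all such methods with average error at most $\varepsilon$.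 For $n=p^d$ with an integer $p\ge1$, partition $D$ into $n$ equal cubes $U_j=x_j+[-\frac1{2p},\frac1{2p}]^d$ with centres $x_j$. Let $\phi_n^{\mathrm{Int}}$ be Haber's modified Monte Carlo rule $\frac1n\sum_{j=1}^n f(t_j)$, where the $t_j$ are independent and $t_j$ is uniformly distributed in $U_j$, and let $\phi_n^{\mathrm{App}}$ be the piecewise constant approximation $\sum_{j=1}^n g_j(\cdot)f(x_j)$, where $g_j$ is the indicator function of $U_j$. Then the following hold. (a) For every such $n$, both methods have average cost $n$, and the average errors of $\phi_n^{\mathrm{Int}}$ and $\phi_n^{\mathrm{App}}$ are respectively equal to $$\frac{\sqrt{\int_D\int_D\|x-y\|/2\,dx\,dy}}{n^{1/2+1/(2d)}}\qquad\text{and}\qquad\frac{\sqrt{\int_D\|x\|/2\,dx}}{n^{1/(2d)}}.$$ (b) For $\varepsilon>0$ let $$n^{\mathrm{Int}}(\varepsilon)=\left\lceil\left(\varepsilon^{-2}\int_D\int_D\|x-y\|/2\,dx\,dy\right)^{1/(d+1)}\right\rceil^d,\qquad n^{\mathrm{App}}(\varepsilon)=\left\lceil\varepsilon^{-2}\int_D\|x\|/2\,dx\right\rceil^d.$$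 Then $\phi^{\mathrm{Int}}_{n^{\mathrm{Int}}(\varepsilon)}$ and $\phi^{\mathrm{App}}_{n^{\mathrm{App}}(\varepsilon)}$ have average errors at most $\varepsilon$ for the respective problems. (c) These methods are almost optimal: the complexities are finite for every $\varepsilon>0$ and, as $\varepsilon\to0^+$, with constants depending only on $d$, the average cost of $\phi^{\mathrm{Int}}_{n^{\mathrm{Int}}(\varepsilon)}$ is $\Theta(\mathrm{comp}(\varepsilon,\mathrm{Int}))$ and $\Theta(\varepsilon^{-2/(1+1/d)})$, and the average cost of $\phi^{\mathrm{App}}_{n^{\mathrm{App}}(\varepsilon)}$ is $\Theta(\mathrm{comp}(\varepsilon,\mathrm{App}))$ and $\Theta(\varepsilon^{-2d})$. -/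

import Mathlib

open MeasureTheory ProbabilityTheory Filter Topology Asymptotics

open scoped ENNReal

/-! ### The domain `D = [0,1]^d`, the function class `C(D)`, the isotropic Wiener measure -/

/-- The unit cube `[0,1]^d` in Euclidean space. -/
def unitCube (d : ℕ) : Set (EuclideanSpace ℝ (Fin d)) :=
  {x | ∀ i, x i ∈ Set.Icc (0 : ℝ) 1}

/-- The domain `D = [0,1]^d` as a type; its distance is the Euclidean one. -/
abbrev Cube (d : ℕ) : Type := ↥(unitCube d)

theorem unitCube_eq_preimage (d : ℕ) :
    unitCube d = (fun x : EuclideanSpace ℝ (Fin d) => x.ofLp) ⁻¹'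
      (Set.univ.pi fun _ => Set.Icc (0 : ℝ) 1) := by
  ext x
  simp only [Set.mem_preimage, Set.mem_univ_pi]
  exact Iff.rfl

theorem isCompact_unitCube (d : ℕ) : IsCompact (unitCube d) := by
  rw [unitCube_eq_preimage]
  exact (EuclideanSpace.equiv (Fin d) ℝ).toHomeomorph.isCompact_preimage.2
    (isCompact_univ_pi fun _ => isCompact_Icc)

theorem measurableSet_unitCube (d : ℕ) : MeasurableSet (unitCube d) :=
  (isCompact_unitCube d).isClosed.measurableSet

instance instCompactSpaceCube (d : ℕ) : CompactSpace (Cube d) :=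
  isCompact_iff_compactSpace.1 (isCompact_unitCube d)

/-- Lebesgue measure on `D`. -/
noncomputable instance instMeasureSpaceCube (d : ℕ) : MeasureSpace (Cube d) :=
  Measure.Subtype.measureSpace

theorem volume_cube_apply (d : ℕ) (s : Set (Cube d)) :
    (volume : Measure (Cube d)) s = volume ((↑) '' s : Set (EuclideanSpace ℝ (Fin d))) :=
  comap_subtype_coe_apply (measurableSet_unitCube d) volume s

instance instIsFiniteMeasureCube (d : ℕ) : IsFiniteMeasure (volume : Measure (Cube d)) where
  measure_univ_lt_top := by
    rw [volume_cube_apply, Set.image_univ, Subtype.range_coe]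
    exact (isCompact_unitCube d).measure_lt_top

/-- The Borel σ-algebra of the Banach space `C(D)`. -/
instance instMeasurableSpaceCont (d : ℕ) : MeasurableSpace C(Cube d, ℝ) := borel _

instance instBorelSpaceCont (d : ℕ) : BorelSpace C(Cube d, ℝ) := ⟨rfl⟩

/-- `μ` is the isotropic Wiener measure (Lévy's Brownian motion) on `C(D)`: the zero-mean Gaussian
Borel measure with covariance function `K(x, y) = (‖x‖ + ‖y‖ - ‖x - y‖) / 2`. -/
structure IsIsotropicWiener {d : ℕ} (μ : Measure C(Cube d, ℝ)) : Prop where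
  isGaussian : IsGaussian μ
  mean_zero : ∀ x : Cube d, ∫ f, f x ∂μ = 0
  covariance : ∀ x y : Cube d, ∫ f, f x * f y ∂μ =
    (‖(x : EuclideanSpace ℝ (Fin d))‖ + ‖(y : EuclideanSpace ℝ (Fin d))‖
      - ‖(x : EuclideanSpace ℝ (Fin d)) - y‖) / 2

/-! ### Randomized adaptive algorithms using function values -/

/-- A randomized, adaptive method with values in `G`. First an outcome `t : Ω` is drawn from the distribution `P`.
Then the method evaluates `f` at points chosen one after the other: if `y` is the list of the values
computed so far (oldest first), then `next t y = some x` means that `f x` is evaluated next, and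
`next t y = none` that no more values are computed; in this case the approximation `out t y` is
returned. -/
structure RandomizedMethod (d : ℕ) (G : Type*) where
  Ω : Type
  [mΩ : MeasurableSpace Ω]
  P : Measure Ω
  [isProb : IsProbabilityMeasure P]
  next : Ω → List ℝ → Option (Cube d)
  out : Ω → List ℝ → G

attribute [instance] RandomizedMethod.mΩ RandomizedMethod.isProb

namespace RandomizedMethod

variable {d : ℕ} {G : Type*} (A : RandomizedMethod d G)

/-- The values computed within the first `k` steps. -/
def transcript (f : C(Cube d, ℝ)) (t : A.Ω) : ℕ → List ℝ
  | 0 => []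
  | k + 1 =>
    match A.next t (transcript f t k) with
    | none => transcript f t k
    | some x => transcript f t k ++ [f x]

/-- The cardinality `n(f)`: the number of values of `f` that are computed
(`⊤` if the method never stops). -/
noncomputable def card (f : C(Cube d, ℝ)) (t : A.Ω) : ℕ∞ :=
  ⨆ k, ((A.transcript f t k).length : ℕ∞)

/-- The information `N_t(f)`: the list of all computed values (if there are finitely many). -/
noncomputable def info (f : C(Cube d, ℝ)) (t : A.Ω) : List ℝ :=
  A.transcript f t (A.card f t).toNat

/-- The approximation `φ_t(N_t(f))`. -/
noncomputable def approx (f : C(Cube d, ℝ)) (t : A.Ω) : G :=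
  A.out t (A.info f t)

/-- The average cost `E_μ E_t n(f)`. -/
noncomputable def avgCost (μ : Measure C(Cube d, ℝ)) : ℝ≥0∞ :=
  ∫⁻ f, ∫⁻ t, (A.card f t : ℝ≥0∞) ∂A.P ∂μ

/-- The average error: the square root of `E_μ E_t ‖S(f) - φ_t(N_t(f))‖²`. -/
noncomputable def avgError [NormedAddCommGroup G] (S : C(Cube d, ℝ) → G)
    (μ : Measure C(Cube d, ℝ)) : ℝ≥0∞ :=
  (∫⁻ f, ∫⁻ t, ‖S f - A.approx f t‖ₑ ^ 2 ∂A.P ∂μ) ^ (1 / 2 : ℝ)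

/-- The expectations that define the average cost and the average error make sense: the cardinality
and the pointwise error are measurable (up to null sets) as functions of `(f, t)`. Nothing else is
required of the choice of the points, of the stopping rule and of the mapping `out`. -/
structure IsAdmissible [NormedAddCommGroup G] (S : C(Cube d, ℝ) → G)
    (μ : Measure C(Cube d, ℝ)) : Prop where
  aemeasurable_card :
    AEMeasurable (fun z : C(Cube d, ℝ) × A.Ω => (A.card z.1 z.2 : ℝ≥0∞)) (μ.prod A.P)
  aemeasurable_error :
    AEMeasurable (fun z : C(Cube d, ℝ) × A.Ω => ‖S z.1 - A.approx z.1 z.2‖ₑ) (μ.prod A.P)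

end RandomizedMethod

/-- The average-case complexity: the infimum of the average costs of all randomized adaptive methods
whose average error is at most `ε`. -/
noncomputable def avgComplexity {d : ℕ} {G : Type*} [NormedAddCommGroup G] (ε : ℝ)
    (S : C(Cube d, ℝ) → G) (μ : Measure C(Cube d, ℝ)) : ℝ≥0∞ :=
  ⨅ (A : RandomizedMethod d G) (_ : A.IsAdmissible S μ ∧ A.avgError S μ ≤ ENNReal.ofReal ε),
    A.avgCost μ

/-! ### The two problems -/

/-- The integration problem, `Int(f) = ∫_D f(x) dx`. -/
noncomputable def IntProblem (d : ℕ) (f : C(Cube d, ℝ)) : ℝ :=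
  ∫ x, f x

/-- The approximation problem, `App(f) = f` as an element of `L_2(D)`. -/
noncomputable def AppProblem (d : ℕ) (f : C(Cube d, ℝ)) : Lp ℝ 2 (volume : Measure (Cube d)) :=
  ContinuousMap.toLp 2 volume ℝ f

/-! ### The partition of `D` into `n = p ^ d` cubes -/

/-- The `i`-th coordinate of the centre of the `j`-th cube. The cubes are numbered by the `d`-digit
numbers in base `p`, and the `i`-th digit of `j` is the position of the cube along the `i`-th
axis. -/
noncomputable def centerCoord (d p : ℕ) (j : Fin (p ^ d)) (i : Fin d) : ℝ :=
  (((finFunctionFinEquiv.symm j i : Fin p) : ℕ) + 1 / 2) / p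

theorem centerCoord_bounds (d p : ℕ) (j : Fin (p ^ d)) (i : Fin d) :
    1 / (2 * (p : ℝ)) ≤ centerCoord d p j i ∧ centerCoord d p j i ≤ 1 - 1 / (2 * (p : ℝ)) := by
  have hk : ((finFunctionFinEquiv.symm j i : Fin p) : ℕ) + 1 ≤ p := (finFunctionFinEquiv.symm j i).2
  unfold centerCoord
  generalize ((finFunctionFinEquiv.symm j i : Fin p) : ℕ) = k at hk
  have hp : (0 : ℝ) < p := by
    have : 0 < p := by omega
    exact_mod_cast this
  have hk' : (k : ℝ) + 1 ≤ p := by exact_mod_cast hk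
  have hk0 : (0 : ℝ) ≤ k := Nat.cast_nonneg k
  constructor
  · rw [div_le_div_iff₀ (by positivity) hp]
    nlinarith
  · rw [div_le_iff₀ hp, sub_mul]
    have : 1 / (2 * (p : ℝ)) * p = 1 / 2 := by field_simp
    linarith

theorem half_side_nonneg (p : ℕ) : 0 ≤ 1 / (2 * (p : ℝ)) := by positivity

/-- The centre `x_j` of the `j`-th cube. -/
noncomputable def center (d p : ℕ) (j : Fin (p ^ d)) : Cube d :=
  ⟨WithLp.toLp 2 (centerCoord d p j), fun i =>
    ⟨(half_side_nonneg p).trans (centerCoord_bounds d p j i).1,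
      (centerCoord_bounds d p j i).2.trans (sub_le_self _ (half_side_nonneg p))⟩⟩

/-- The `j`-th cube `U_j = x_j + [-1/(2p), 1/(2p)]^d`. -/
def subcube (d p : ℕ) (j : Fin (p ^ d)) : Set (Cube d) :=
  {x | ∀ i, |x.1 i - (center d p j).1 i| ≤ 1 / (2 * (p : ℝ))}

theorem measurableSet_subcube (d p : ℕ) (j : Fin (p ^ d)) : MeasurableSet (subcube d p j) := by
  have : IsClosed (subcube d p j) := by
    simp only [subcube, Set.ofPred_forall]
    refine isClosed_iInter fun i => isClosed_le ?_ continuous_const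
    fun_prop
  exact this.measurableSet

theorem coe_image_subcube (d p : ℕ) (j : Fin (p ^ d)) :
    ((↑) '' subcube d p j : Set (EuclideanSpace ℝ (Fin d))) =
      (fun x : EuclideanSpace ℝ (Fin d) => x.ofLp) ⁻¹' (Set.univ.pi fun i =>
        Set.Icc (centerCoord d p j i - 1 / (2 * (p : ℝ)))
          (centerCoord d p j i + 1 / (2 * (p : ℝ)))) := by
  ext x
  simp only [Set.mem_image, Set.mem_preimage, Set.mem_univ_pi, Set.mem_Icc]
  constructor
  · rintro ⟨y, hy, rfl⟩ i
    have h := abs_le.1 (hy i)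
    change -(1 / (2 * (p : ℝ))) ≤ y.1 i - centerCoord d p j i ∧
      y.1 i - centerCoord d p j i ≤ 1 / (2 * (p : ℝ)) at h
    constructor <;> linarith [h.1, h.2]
  · intro h
    refine ⟨⟨x, fun i => ?_⟩, fun i => ?_, rfl⟩
    · have hb := centerCoord_bounds d p j i
      constructor <;> linarith [(h i).1, (h i).2, hb.1, hb.2]
    · change |x i - centerCoord d p j i| ≤ 1 / (2 * (p : ℝ))
      rw [abs_le]
      constructor <;> linarith [(h i).1, (h i).2]

theorem volume_subcube_ne_zero (d p : ℕ) (j : Fin (p ^ d)) : volume (subcube d p j) ≠ 0 := by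
  rw [volume_cube_apply, coe_image_subcube,
    (PiLp.volume_preserving_ofLp (Fin d)).measure_preimage
      (MeasurableSet.univ_pi fun _ => measurableSet_Icc).nullMeasurableSet,
    volume_pi_pi, Finset.prod_ne_zero_iff]
  intro i _
  have hp : (0 : ℝ) < p := by
    have : 0 < p := (Nat.zero_le _).trans_lt (finFunctionFinEquiv.symm j i : Fin p).2
    exact_mod_cast this
  have h : 0 < 1 / (2 * (p : ℝ)) := by positivity
  rw [Real.volume_Icc, Ne, ENNReal.ofReal_eq_zero, not_le]
  linarith

/-! ### The two methods -/

/-- The uniform distribution on the cube `U_j`. -/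
noncomputable def uniformSubcube (d p : ℕ) (j : Fin (p ^ d)) : Measure (Cube d) :=
  cond volume (subcube d p j)

instance instIsProbabilityMeasureUniformSubcube (d p : ℕ) (j : Fin (p ^ d)) :
    IsProbabilityMeasure (uniformSubcube d p j) :=
  cond_isProbabilityMeasure (volume_subcube_ne_zero d p j)

/-- Haber's modified Monte Carlo quadrature with `n = p ^ d` points: the random outcome is a tuple
`t` of independent points `t_j`, each uniformly distributed in the cube `U_j`; the values `f(t_j)`
are computed in turn and their arithmetic mean is returned. -/
noncomputable def haberMethod (d p : ℕ) : RandomizedMethod d ℝ where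
  Ω := Fin (p ^ d) → Cube d
  P := Measure.pi (uniformSubcube d p)
  next t y := if h : y.length < p ^ d then some (t ⟨y.length, h⟩) else none
  out _ y := 1 / ((p ^ d : ℕ) : ℝ) * y.sum

/-- The piecewise constant approximation with `n = p ^ d` pieces, `∑_j g_j(·) f(x_j)` with `g_j` the
indicator function of the cube `U_j` and `x_j` its centre. It is deterministic. -/
noncomputable def piecewiseConstMethod (d p : ℕ) :
    RandomizedMethod d (Lp ℝ 2 (volume : Measure (Cube d))) where
  Ω := Unit
  P := Measure.dirac ()
  next _ y := if h : y.length < p ^ d then some (center d p ⟨y.length, h⟩) else none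
  out _ y := ∑ j : Fin (p ^ d), y.getD j 0 •
    indicatorConstLp 2 (measurableSet_subcube d p j) (measure_ne_top volume (subcube d p j)) (1 : ℝ)

/-! ### The constants and the choices of `n` -/

/-- `∫_D ∫_D ‖x - y‖ / 2 dx dy`. -/
noncomputable def intConst (d : ℕ) : ℝ :=
  ∫ y : Cube d, ∫ x : Cube d, ‖(x : EuclideanSpace ℝ (Fin d)) - y‖ / 2

/-- `∫_D ‖x‖ / 2 dx`. -/
noncomputable def appConst (d : ℕ) : ℝ :=
  ∫ x : Cube d, ‖(x : EuclideanSpace ℝ (Fin d))‖ / 2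

/-- The number `p` of cubes along each axis for the integration problem; `n = p ^ d`. -/
noncomputable def pInt (d : ℕ) (ε : ℝ) : ℕ :=
  ⌈(ε ^ (-2 : ℤ) * intConst d) ^ (1 / ((d : ℝ) + 1))⌉₊

/-- The number `p` of cubes along each axis for the approximation problem; `n = p ^ d`. -/
noncomputable def pApp (d : ℕ) (ε : ℝ) : ℕ :=
  ⌈ε ^ (-2 : ℤ) * appConst d⌉₊

/-!
The costs and errors of the two methods are computed directly. For fixed `f` the points of Haber's
rule are independent and the rule is unbiased, so its mean square error is the sum of the variances
of `f` within the subcubes, divided by `n²`; a variance is half the mean square of `f(t) - f(t')`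
with independent copies `t`, `t'`, and averaging over `f` turns `(f(t) - f(t'))²` into `‖t - t'‖`
(`IsIsotropicWiener.lintegral_increment_sq`). Likewise the squared error of the piecewise constant
method averages to the integral of `‖x - x_j‖` over the subcubes. Since each subcube is a homothetic
image of `D` (`uniformSubcube_eq_map`), everything scales to integrals over `D`; the integral of the
distance to the centre of `D` is half that of the norm because `u ↦ |2u - 1|` preserves Lebesgue
measure on `[0,1]`.

The substance is the lower bound for arbitrary randomized adaptive methods. It rests on a
decomposition: for every `p`, the random function `f` has the law of `g + ∑ⱼ ζⱼ hⱼ`, where the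
`p ^ d` functions `hⱼ ≥ 0` have disjoint supports and size of order `p ^ (-1/2)` on a ball of radius
of order `1 / p`, and the `ζⱼ` are standard normal, independent of each other and of `g`
(`IsIsotropicWiener.exists_bumps`).

* *Where the bumps come from.* Let `e_x(u, r) = (r - ‖x - u‖)₊ - (r - ‖u‖)₊` on `ℝ^d × (0, ∞)`
  with the measure `r ^ (-d-2) du dr`. The squared distance of `e_x` and `e_y` in `L²` is invariant
  under motions and homogeneous of degree one under dilations, hence equals `κ ‖x - y‖` with a
  constant `κ`, and it is finite and positive (`exists_coneDist_eq`). So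
  `⟪e_x, e_y⟫ / κ` is the covariance of Lévy's Brownian motion. The indicators of disjoint boxes
  around the points `(x_j, 1 / p)` are orthogonal in `L²`, and their inner products with `e_x`,
  as functions of `x`, are nonnegative and vanish away from `x_j`. These are the bumps.
* *Why the decomposition holds.* If `F` is a unit vector and `h(x) = ⟪F, e_x⟫`, then the covariance
  minus `h(x) h(y)` again belongs to a Gaussian measure on `C(D)`: subtract from `f` the component of
  `f` along `h` and add the missing amount of independent noise in the direction `h`
  (`IsIsonormal.exists_remove`). Iterate this, and compare characteristic functions.
* *Why it bounds the cost.* Fix `g` and the random outcome `t`. Every function value reveals at most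
  one of the `ζⱼ`. A method that stops after `k` values leaves at least `p ^ d - k` of them
  independent standard normal, so its mean square error is at least `(p ^ d - k) b`, where
  `b ≤ ‖S(hⱼ)‖²`. Hence error² `+ b ·` cost is on the average at least `b p ^ d / 2`
  (`RandomizedMethod.le_error_add_cost`). As nothing in the method is measurable except cost and
  error, the induction over the values is carried out for a measurable majorant of error² `+ b ·`
  cost.

With `b` of order `p ^ (-2d-1)` for integration and `p ^ (-d-1)` for approximation, and with `p ^ d`
of order `ε ^ (-2d/(d+1))` and `ε ^ (-2d)` respectively, this gives lower bounds for the complexity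
of the same order as the costs of the two methods.
-/

open scoped RealInnerProductSpace

/-! ### Gaussian processes indexed by a Hilbert space and removal of directions -/

section Isonormal

variable {d : ℕ} {H : Type*} [NormedAddCommGroup H] [InnerProductSpace ℝ H]

/-- The continuous linear functional `f ↦ ∑ₓ c x * f x` on `C(D)`. -/
noncomputable def evalComb (d : ℕ) : (Cube d →₀ ℝ) →ₗ[ℝ] (C(Cube d, ℝ) →L[ℝ] ℝ) :=
  Finsupp.linearCombination ℝ fun x => ContinuousMap.evalCLM ℝ x

theorem evalComb_apply (c : Cube d →₀ ℝ) (f : C(Cube d, ℝ)) :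
    evalComb d c f = c.sum fun x a => a * f x := by
  simp [evalComb, Finsupp.linearCombination_apply, Finsupp.sum]

@[simp]
theorem evalComb_single (x : Cube d) (a : ℝ) (f : C(Cube d, ℝ)) :
    evalComb d (Finsupp.single x a) f = a * f x := by
  simp [evalComb_apply]

/-- Under `ν` the evaluations `f x` form a centred Gaussian family with covariance `⟪e x, e y⟫`,
expressed by the characteristic functions of their linear combinations. -/
def IsIsonormal (e : Cube d → H) (ν : Measure C(Cube d, ℝ)) : Prop :=
  ∀ c : Cube d →₀ ℝ, charFunDual ν (evalComb d c) =
    Complex.exp (-((‖Finsupp.linearCombination ℝ e c‖ ^ 2 : ℝ) : ℂ) / 2)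

theorem IsIsonormal.map_evalComb {e : Cube d → H} {ν : Measure C(Cube d, ℝ)}
    [IsProbabilityMeasure ν] (hν : IsIsonormal e ν) (c : Cube d →₀ ℝ) :
    ν.map (evalComb d c) =
      gaussianReal 0 (‖Finsupp.linearCombination ℝ e c‖ ^ 2).toNNReal := by
  refine Measure.ext_of_charFun ?_
  ext u
  rw [charFun_map_eq_charFunDual_smul, ← map_smul, hν, charFun_gaussianReal, map_smul, norm_smul]
  congr 1
  rw [Real.coe_toNNReal _ (by positivity)]
  push_cast
  rw [mul_pow, ← Complex.ofReal_pow ‖u‖, Real.norm_eq_abs, sq_abs]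
  push_cast
  ring

theorem IsIsonormal.memLp {e : Cube d → H} {ν : Measure C(Cube d, ℝ)}
    [IsProbabilityMeasure ν] (hν : IsIsonormal e ν) (c : Cube d →₀ ℝ) :
    MemLp (evalComb d c) 2 ν := by
  have h := memLp_id_gaussianReal (μ := 0)
    (v := (‖Finsupp.linearCombination ℝ e c‖ ^ 2).toNNReal) 2
  rw [← hν.map_evalComb c] at h
  exact h.comp_of_map (evalComb d c).continuous.aemeasurable

theorem IsIsonormal.integral_sq {e : Cube d → H} {ν : Measure C(Cube d, ℝ)}
    [IsProbabilityMeasure ν] (hν : IsIsonormal e ν) (c : Cube d →₀ ℝ) :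
    ∫ f, (evalComb d c f) ^ 2 ∂ν = ‖Finsupp.linearCombination ℝ e c‖ ^ 2 := by
  have h1 := variance_id_gaussianReal (μ := 0)
    (v := (‖Finsupp.linearCombination ℝ e c‖ ^ 2).toNNReal)
  rw [variance_of_integral_eq_zero aemeasurable_id (by simp), ← hν.map_evalComb c,
    integral_map (evalComb d c).continuous.aemeasurable (by fun_prop)] at h1
  rw [← Real.coe_toNNReal (‖Finsupp.linearCombination ℝ e c‖ ^ 2) (by positivity), ← h1]
  rfl

theorem IsIsonormal.norm_toLp {e : Cube d → H} {ν : Measure C(Cube d, ℝ)}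
    [IsProbabilityMeasure ν] (hν : IsIsonormal e ν) (c : Cube d →₀ ℝ) :
    ‖(hν.memLp c).toLp (evalComb d c)‖ = ‖Finsupp.linearCombination ℝ e c‖ := by
  rw [← sq_eq_sq₀ (norm_nonneg _) (norm_nonneg _), ← hν.integral_sq c, ← real_inner_self_eq_norm_sq,
    L2.inner_def]
  refine integral_congr_ae ?_
  filter_upwards [(hν.memLp c).coeFn_toLp] with f hf
  rw [hf]
  simp [sq]

/-- A vector `v` in the closed span of the `e x` is represented by a random variable `ξ` that is
jointly Gaussian with the evaluations. -/
theorem IsIsonormal.exists_coordinate {e : Cube d → H} {ν : Measure C(Cube d, ℝ)}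
    [IsProbabilityMeasure ν] (hν : IsIsonormal e ν) {v : H}
    (hv : v ∈ closure (Set.range (Finsupp.linearCombination ℝ e))) :
    ∃ ξ : C(Cube d, ℝ) → ℝ, Measurable ξ ∧ ∀ (c : Cube d →₀ ℝ) (s : ℝ),
      ∫ f, Complex.exp (((evalComb d c f + s * ξ f : ℝ) : ℂ) * Complex.I) ∂ν =
        Complex.exp (-((‖Finsupp.linearCombination ℝ e c + s • v‖ ^ 2 : ℝ) : ℂ) / 2) := by
  obtain ⟨w, hw, hlim⟩ := mem_closure_iff_seq_limit.1 hv
  choose a ha using hw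
  obtain rfl : (fun n => Finsupp.linearCombination ℝ e (a n)) = w := funext ha
  set Y : ℕ → Lp ℝ 2 ν := fun n => (hν.memLp (a n)).toLp (evalComb d (a n)) with hY
  have hdist : ∀ m n, dist (Y m) (Y n) =
      dist (Finsupp.linearCombination ℝ e (a m)) (Finsupp.linearCombination ℝ e (a n)) := by
    intro m n
    rw [dist_eq_norm, dist_eq_norm, ← map_sub, ← hν.norm_toLp (a m - a n), hY]
    dsimp only
    rw [← MemLp.toLp_sub]
    congr 2
    ext f
    simp
  have hcau : CauchySeq Y := by
    have h1 := hlim.cauchySeq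
    rw [Metric.cauchySeq_iff] at h1 ⊢
    simpa only [hdist] using h1
  obtain ⟨ξ, hξ⟩ := cauchySeq_tendsto_of_complete hcau
  obtain ⟨ns, hns, hae⟩ := (tendstoInMeasure_of_tendsto_Lp hξ).exists_seq_tendsto_ae
  refine ⟨ξ, (Lp.stronglyMeasurable ξ).measurable, fun c s => ?_⟩
  have hconv : Tendsto (fun n => ∫ f, Complex.exp
      (((evalComb d c f + s * evalComb d (a (ns n)) f : ℝ) : ℂ) * Complex.I) ∂ν) atTop
      (𝓝 (∫ f, Complex.exp (((evalComb d c f + s * ξ f : ℝ) : ℂ) * Complex.I) ∂ν)) := by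
    refine tendsto_integral_of_dominated_convergence (fun _ => 1) (fun n => ?_)
      (integrable_const _) (fun n => ae_of_all _ fun f => ?_) ?_
    · exact Continuous.aestronglyMeasurable (by fun_prop)
    · rw [Complex.norm_exp_ofReal_mul_I]
    · have h2 : ∀ᵐ f ∂ν, ∀ n, Y (ns n) f = evalComb d (a (ns n)) f :=
        ae_all_iff.2 fun n => (hν.memLp (a (ns n))).coeFn_toLp
      filter_upwards [hae, h2] with f hf hf2
      simp only [hf2] at hf
      refine (Complex.continuous_exp.tendsto _).comp (Tendsto.mul_const _ ?_)
      exact (Complex.continuous_ofReal.tendsto _).comp ((hf.const_mul s).const_add _)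
  refine tendsto_nhds_unique hconv ?_
  have heq : ∀ n, ∫ f, Complex.exp
      (((evalComb d c f + s * evalComb d (a (ns n)) f : ℝ) : ℂ) * Complex.I) ∂ν =
      Complex.exp (-((‖Finsupp.linearCombination ℝ e c +
        s • Finsupp.linearCombination ℝ e (a (ns n))‖ ^ 2 : ℝ) : ℂ) / 2) := by
    intro n
    have := hν (c + s • a (ns n))
    rw [charFunDual_apply] at this
    simpa using this
  simp only [heq]
  have hl := hlim.comp hns.tendsto_atTop
  refine (Complex.continuous_exp.tendsto _).comp (Tendsto.div_const (Tendsto.neg ?_) _)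
  refine (Complex.continuous_ofReal.tendsto _).comp (Tendsto.pow (Tendsto.norm ?_) 2)
  exact (hl.const_smul s).const_add _

/-- If `F` is a unit vector, then `K(x, y) - ⟪F, e x⟫ ⟪F, e y⟫` is again the covariance of a Gaussian
measure on `C(D)`: subtract from `f` its component along `h = ⟪F, e ·⟫`, and add an independent
multiple of `h` to compensate for the part of `F` that is orthogonal to all `e x`. -/
theorem IsIsonormal.exists_remove [CompleteSpace H] {e : Cube d → H} {ν : Measure C(Cube d, ℝ)}
    [IsProbabilityMeasure ν] (hν : IsIsonormal e ν) {F : H} (hF : ‖F‖ = 1) (h : C(Cube d, ℝ))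
    (hh : ∀ x, h x = ⟪F, e x⟫) :
    ∃ ν' : Measure C(Cube d, ℝ), IsProbabilityMeasure ν' ∧
      IsIsonormal (fun x => e x - ⟪F, e x⟫ • F) ν' := by
  set T := Finsupp.linearCombination ℝ e with hT
  set V : Submodule ℝ H := (LinearMap.range T).topologicalClosure with hV
  have : CompleteSpace V := (Submodule.isClosed_topologicalClosure _).completeSpace_coe
  set v : H := V.starProjection F with hvdef
  have hvV : v ∈ V := Submodule.starProjection_apply_mem V F
  have hin : ∀ c, ⟪v, T c⟫ = ⟪F, T c⟫ := by
    intro c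
    have hc : T c ∈ V := Submodule.le_topologicalClosure _ (LinearMap.mem_range_self T c)
    have := Submodule.starProjection_inner_eq_zero (K := V) F (T c) hc
    rw [inner_sub_left, sub_eq_zero] at this
    exact this.symm
  have hv1 : ‖v‖ ^ 2 ≤ 1 := by
    have : ‖v‖ ≤ ‖F‖ := Submodule.norm_starProjection_apply_le V F
    rw [hF] at this
    nlinarith [norm_nonneg v]
  have hvcl : v ∈ closure (Set.range T) := by
    have := hvV
    rw [hV, ← SetLike.mem_coe, Submodule.topologicalClosure_coe, LinearMap.coe_range] at this
    exact this
  obtain ⟨ξ, hξm, hξ⟩ := hν.exists_coordinate hvcl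
  set b : ℝ := √(1 - ‖v‖ ^ 2) with hb
  have hb2 : b ^ 2 = 1 - ‖v‖ ^ 2 := Real.sq_sqrt (by linarith)
  set Φ : C(Cube d, ℝ) × ℝ → C(Cube d, ℝ) := fun p => p.1 + (-ξ p.1 + b * p.2) • h with hΦ
  have hΦm : Measurable Φ := by
    have h1 : Measurable fun p : C(Cube d, ℝ) × ℝ => -ξ p.1 + b * p.2 := by fun_prop
    have h2 : Continuous fun r : ℝ => r • h := by fun_prop
    exact measurable_fst.add (h2.measurable.comp h1)
  refine ⟨(ν.prod (gaussianReal 0 1)).map Φ,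
    Measure.isProbabilityMeasure_map hΦm.aemeasurable, fun c => ?_⟩
  have hcomb : Finsupp.linearCombination ℝ (fun x => e x - ⟪F, e x⟫ • F) c
      = T c - ⟪F, T c⟫ • F := by
    rw [hT, Finsupp.linearCombination_apply, Finsupp.linearCombination_apply]
    simp only [Finsupp.sum, inner_sum, Finset.sum_smul, ← Finset.sum_sub_distrib, smul_sub,
      real_inner_smul_right, smul_smul]
  have hch : evalComb d c h = ⟪F, T c⟫ := by
    rw [hT, evalComb_apply, Finsupp.linearCombination_apply]
    simp only [Finsupp.sum, inner_sum, real_inner_smul_right, hh]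
  set θ := ⟪F, T c⟫ with hθ
  rw [charFunDual_apply, integral_map hΦm.aemeasurable
    (Continuous.aestronglyMeasurable (by fun_prop)), hcomb]
  have hsplit : ∀ p : C(Cube d, ℝ) × ℝ, Complex.exp ((evalComb d c (Φ p) : ℂ) * Complex.I) =
      Complex.exp (((evalComb d c p.1 + (-θ) * ξ p.1 : ℝ) : ℂ) * Complex.I) *
        Complex.exp (((θ * b : ℝ) : ℂ) * p.2 * Complex.I) := by
    intro p
    rw [← Complex.exp_add, hΦ]
    congr 1
    simp only [map_add, map_smul, hch, smul_eq_mul]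
    push_cast
    ring
  simp only [hsplit]
  rw [integral_prod_mul (fun f => Complex.exp (((evalComb d c f + (-θ) * ξ f : ℝ) : ℂ) * Complex.I))
    (fun z : ℝ => Complex.exp (((θ * b : ℝ) : ℂ) * z * Complex.I)), hξ]
  have hg := charFun_gaussianReal (μ := 0) (v := 1) (θ * b)
  rw [charFun_apply_real] at hg
  rw [hg, ← Complex.exp_add]
  congr 1
  have hn : ‖T c - θ • F‖ ^ 2 = ‖T c + (-θ) • v‖ ^ 2 + (θ * b) ^ 2 := by
    rw [norm_sub_sq_real, norm_add_sq_real, real_inner_smul_right, real_inner_smul_right,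
      norm_smul, norm_smul, real_inner_comm, real_inner_comm v, hin, ← hθ, mul_pow, mul_pow, mul_pow,
      hb2, hF]
    simp only [Real.norm_eq_abs, sq_abs]
    ring
  rw [hn]
  push_cast
  ring

/-- Finite measures on `C(D)` are determined by the characteristic functions of linear combinations
of evaluations. -/
theorem ext_of_charFunDual_evalComb {μ ν : Measure C(Cube d, ℝ)} [IsFiniteMeasure μ]
    [IsFiniteMeasure ν] (h : ∀ c, charFunDual μ (evalComb d c) = charFunDual ν (evalComb d c)) :
    μ = ν := by
  let : TopologicalSpace (Cube d →₀ ℝ) := ⊥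
  have : DiscreteTopology (Cube d →₀ ℝ) := ⟨rfl⟩
  let L : C(Cube d, ℝ) →ₗ[ℝ] (Cube d →₀ ℝ) →ₗ[ℝ] ℝ :=
    LinearMap.flip ((ContinuousLinearMap.coeLM ℝ).comp (evalComb d))
  have hL : ∀ f c, L f c = evalComb d c f := fun f c => rfl
  have hcont : Continuous fun p : C(Cube d, ℝ) × (Cube d →₀ ℝ) => L p.1 p.2 := by
    rw [continuous_prod_of_discrete_right]
    intro c
    simp only [hL]
    fun_prop
  refine ext_of_integral_char_eq Real.continuous_probChar Real.probChar_ne_one (L := L) ?_ hcont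
    fun c => ?_
  · intro f hf h0
    refine hf (ContinuousMap.ext fun x => ?_)
    have := congrArg (fun l => l (Finsupp.single x 1)) h0
    simpa [hL] using this
  · have := h c
    rw [charFunDual_apply, charFunDual_apply] at this
    simpa [BoundedContinuousFunction.char_apply, hL, Real.probChar_apply] using this

/-- The Gaussian measure with covariance `⟪e x, e y⟫` is the law of `g + ∑ⱼ ζⱼ hⱼ`, with independent
standard normal `ζⱼ` that are independent of `g`, whenever `hⱼ = ⟪Fⱼ, e ·⟫` for an orthonormal
family `F`. -/
theorem IsIsonormal.exists_decomposition [CompleteSpace H] {e : Cube d → H}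
    {μ : Measure C(Cube d, ℝ)} [IsProbabilityMeasure μ] (hμ : IsIsonormal e μ) {ι : Type*}
    [Fintype ι] {F : ι → H} (hF : Orthonormal ℝ F) (h : ι → C(Cube d, ℝ))
    (hh : ∀ j x, h j x = ⟪F j, e x⟫) :
    ∃ ν : Measure C(Cube d, ℝ), IsProbabilityMeasure ν ∧
      (ν.prod (Measure.pi fun _ : ι => gaussianReal 0 1)).map
        (fun p => p.1 + ∑ j, p.2 j • h j) = μ := by
  classical
  have key : ∀ s : Finset ι, ∃ ν : Measure C(Cube d, ℝ), IsProbabilityMeasure ν ∧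
      IsIsonormal (fun x => e x - ∑ j ∈ s, ⟪F j, e x⟫ • F j) ν := by
    intro s
    induction s using Finset.induction_on with
    | empty => exact ⟨μ, inferInstance, by simpa using hμ⟩
    | insert k s hk ih =>
      obtain ⟨ν, hν, hiso⟩ := ih
      have hk' : ∀ x, ⟪F k, e x - ∑ j ∈ s, ⟪F j, e x⟫ • F j⟫ = ⟪F k, e x⟫ := by
        intro x
        rw [inner_sub_right, inner_sum, Finset.sum_eq_zero, sub_zero]
        intro j hj
        rw [real_inner_smul_right, hF.2 (ne_of_mem_of_not_mem hj hk).symm, mul_zero]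
      obtain ⟨ν', hν', hiso'⟩ := hiso.exists_remove (hF.1 k) (h k) fun x => by rw [hk', hh]
      refine ⟨ν', hν', ?_⟩
      convert hiso' using 2 with x
      rw [hk', Finset.sum_insert hk]
      abel
  obtain ⟨ν, hν, hiso⟩ := key Finset.univ
  refine ⟨ν, hν, ?_⟩
  have hΦc : Continuous fun p : C(Cube d, ℝ) × (ι → ℝ) => p.1 + ∑ j, p.2 j • h j := by fun_prop
  have hΦm := hΦc.measurable
  have := Measure.isProbabilityMeasure_map
    (μ := ν.prod (Measure.pi fun _ : ι => gaussianReal 0 1)) hΦm.aemeasurable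
  refine ext_of_charFunDual_evalComb fun c => ?_
  rw [hμ c, charFunDual_apply, integral_map hΦm.aemeasurable
    (Continuous.aestronglyMeasurable (by fun_prop))]
  set T := Finsupp.linearCombination ℝ e with hT
  have hcomb : Finsupp.linearCombination ℝ (fun x => e x - ∑ j, ⟪F j, e x⟫ • F j) c
      = T c - ∑ j, ⟪F j, T c⟫ • F j := by
    rw [hT, Finsupp.linearCombination_apply, Finsupp.linearCombination_apply]
    simp only [Finsupp.sum, inner_sum, Finset.sum_smul, smul_sub, Finset.sum_sub_distrib,
      real_inner_smul_right, Finset.smul_sum, smul_smul]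
    rw [Finset.sum_comm]
  have hch : ∀ j, evalComb d c (h j) = ⟪F j, T c⟫ := by
    intro j
    rw [hT, evalComb_apply, Finsupp.linearCombination_apply]
    simp only [Finsupp.sum, inner_sum, real_inner_smul_right, hh]
  have hsplit : ∀ p : C(Cube d, ℝ) × (ι → ℝ),
      Complex.exp ((evalComb d c (p.1 + ∑ j, p.2 j • h j) : ℂ) * Complex.I) =
      Complex.exp ((evalComb d c p.1 : ℂ) * Complex.I) *
        ∏ j, Complex.exp ((⟪F j, T c⟫ : ℂ) * p.2 j * Complex.I) := by
    intro p
    rw [← Complex.exp_sum, ← Complex.exp_add]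
    congr 1
    simp only [map_add, map_sum, map_smul, hch, smul_eq_mul]
    push_cast
    rw [add_mul, Finset.sum_mul]
    congr 1
    exact Finset.sum_congr rfl fun j _ => by ring
  simp only [hsplit]
  rw [integral_prod_mul (fun f => Complex.exp ((evalComb d c f : ℂ) * Complex.I))
    (fun z : ι → ℝ => ∏ j, Complex.exp ((⟪F j, T c⟫ : ℂ) * z j * Complex.I)),
    integral_fintype_prod_eq_prod (fun j (z : ℝ) => Complex.exp ((⟪F j, T c⟫ : ℂ) * z * Complex.I))]
  have h1 := hiso c
  rw [charFunDual_apply] at h1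
  have hg : ∀ j, ∫ z : ℝ, Complex.exp ((⟪F j, T c⟫ : ℂ) * z * Complex.I) ∂(gaussianReal 0 1) =
      Complex.exp (-((⟪F j, T c⟫ ^ 2 : ℝ) : ℂ) / 2) := by
    intro j
    have hg := charFun_gaussianReal (μ := 0) (v := 1) ⟪F j, T c⟫
    rw [charFun_apply_real] at hg
    rw [hg]
    congr 1
    push_cast
    ring
  simp only [hg]
  rw [h1, hcomb, ← Complex.exp_sum, ← Complex.exp_add]
  congr 1
  have hpyth : ‖T c - ∑ j, ⟪F j, T c⟫ • F j‖ ^ 2 + ∑ j, ⟪F j, T c⟫ ^ 2 = ‖T c‖ ^ 2 := by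
    have h3 : ⟪T c, ∑ j, ⟪F j, T c⟫ • F j⟫ = ∑ j, ⟪F j, T c⟫ ^ 2 := by
      rw [inner_sum]
      refine Finset.sum_congr rfl fun j _ => ?_
      rw [real_inner_smul_right, real_inner_comm, sq]
    have h4 : ‖∑ j, ⟪F j, T c⟫ • F j‖ ^ 2 = ∑ j, ⟪F j, T c⟫ ^ 2 := by
      rw [← real_inner_self_eq_norm_sq, hF.inner_sum]
      exact Finset.sum_congr rfl fun j _ => by simp [sq]
    rw [norm_sub_sq_real, h3, h4]
    ring
  rw [← hpyth, ← Finset.sum_div, Finset.sum_neg_distrib]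
  push_cast
  ring

end Isonormal

/-! ### Adaptive information about a Gaussian sum of functions with disjoint supports -/

section Transcript

variable {d : ℕ} {G : Type*} (A : RandomizedMethod d G) (f : C(Cube d, ℝ)) (t : A.Ω)

theorem RandomizedMethod.transcript_add_of_next_eq_none {k : ℕ}
    (h : A.next t (A.transcript f t k) = none) (m : ℕ) :
    A.transcript f t (k + m) = A.transcript f t k := by
  induction m with
  | zero => rfl
  | succ m ih => rw [← add_assoc, transcript, ih, h]

theorem RandomizedMethod.transcript_mono {k l : ℕ} (h : k ≤ l) :
    (A.transcript f t k).length ≤ (A.transcript f t l).length := by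
  induction l, h using Nat.le_induction with
  | base => rfl
  | succ l _ ih =>
    refine ih.trans ?_
    rw [transcript]
    split <;> simp

theorem RandomizedMethod.card_of_next_eq_none {k : ℕ} (hk : (A.transcript f t k).length = k)
    (h : A.next t (A.transcript f t k) = none) : A.card f t = k := by
  refine le_antisymm (iSup_le fun l => ?_) ?_
  · have h1 := A.transcript_mono f t (Nat.le_add_left l k)
    rw [A.transcript_add_of_next_eq_none f t h, hk] at h1
    exact_mod_cast h1
  · refine le_trans ?_ (le_iSup (fun l => ((A.transcript f t l).length : ℕ∞)) k)
    rw [hk]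

theorem RandomizedMethod.approx_of_next_eq_none {k : ℕ} (hk : (A.transcript f t k).length = k)
    (h : A.next t (A.transcript f t k) = none) :
    A.approx f t = A.out t (A.transcript f t k) := by
  rw [approx, info, A.card_of_next_eq_none f t hk h, ENat.toNat_natCast]

end Transcript

section LowerBound

theorem lintegral_gaussian_enorm_add_smul_sq {G : Type*} [NormedAddCommGroup G]
    [InnerProductSpace ℝ G] (w v : G) :
    ∫⁻ z, ‖w + z • v‖ₑ ^ 2 ∂(gaussianReal 0 1) = ENNReal.ofReal (‖w‖ ^ 2 + ‖v‖ ^ 2) := by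
  have h2 : MemLp id 2 (gaussianReal 0 1) := memLp_id_gaussianReal 2
  have hi1 : Integrable (fun z : ℝ => z) (gaussianReal 0 1) := h2.integrable (by norm_num)
  have hi2 : Integrable (fun z : ℝ => z ^ 2) (gaussianReal 0 1) := h2.integrable_sq
  have hexp : ∀ z : ℝ, ‖w + z • v‖ ^ 2 = ‖w‖ ^ 2 + (2 * ⟪w, v⟫ * z + ‖v‖ ^ 2 * z ^ 2) := by
    intro z
    rw [norm_add_sq_real, real_inner_smul_right, norm_smul, mul_pow, Real.norm_eq_abs, sq_abs]
    ring
  have hvar : ∫ z : ℝ, z ^ 2 ∂(gaussianReal 0 1) = 1 := by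
    have h1 := variance_id_gaussianReal (μ := 0) (v := 1)
    rw [variance_of_integral_eq_zero aemeasurable_id (by simp)] at h1
    simpa using h1
  have hi12 : Integrable (fun z : ℝ => 2 * ⟪w, v⟫ * z + ‖v‖ ^ 2 * z ^ 2) (gaussianReal 0 1) :=
    (hi1.const_mul _).add (hi2.const_mul _)
  have hval : ∫ z, ‖w + z • v‖ ^ 2 ∂(gaussianReal 0 1) = ‖w‖ ^ 2 + ‖v‖ ^ 2 := by
    simp only [hexp]
    rw [integral_add (integrable_const _) hi12,
      integral_add (hi1.const_mul _) (hi2.const_mul _), integral_const_mul, integral_const_mul,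
      hvar, integral_id_gaussianReal]
    simp
  rw [← hval, ofReal_integral_eq_lintegral_ofReal]
  · refine lintegral_congr fun z => ?_
    rw [ENNReal.ofReal_pow (norm_nonneg _), ofReal_norm]
  · simp only [hexp]
    exact (integrable_const _).add hi12
  · exact ae_of_all _ fun z => sq_nonneg _

/-- The coordinates in `s` being independent standard normal variables and the others fixed, the
mean square of `c + ∑ⱼ ζⱼ vⱼ` is at least the variance coming from the coordinates in `s`. -/
theorem le_lmarginal_enorm_sq {ι G : Type*} [Fintype ι] [DecidableEq ι] [NormedAddCommGroup G]
    [InnerProductSpace ℝ G] (c : G) (v : ι → G) (s : Finset ι) (ζ₀ : ι → ℝ) :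
    ENNReal.ofReal (∑ j ∈ s, ‖v j‖ ^ 2) ≤
      (∫⋯∫⁻_s, (fun ζ : ι → ℝ => ‖c + ∑ j, ζ j • v j‖ₑ ^ 2) ∂fun _ => gaussianReal 0 1) ζ₀ := by
  have hm : Measurable fun ζ : ι → ℝ => ‖c + ∑ j, ζ j • v j‖ₑ ^ 2 :=
    Continuous.measurable (by fun_prop)
  suffices h : ∀ ζ₀ : ι → ℝ,
      ENNReal.ofReal (∑ j ∈ s, ‖v j‖ ^ 2) + ‖c + ∑ j ∈ sᶜ, ζ₀ j • v j‖ₑ ^ 2 =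
      (∫⋯∫⁻_s, (fun ζ : ι → ℝ => ‖c + ∑ j, ζ j • v j‖ₑ ^ 2) ∂fun _ => gaussianReal 0 1) ζ₀ from
    le_self_add.trans (h ζ₀).le
  induction s using Finset.induction_on with
  | empty => intro ζ₀; simp
  | insert i s hi ih =>
    intro ζ₀
    rw [lmarginal_insert _ hm hi]
    have hsum : ∀ z : ℝ, c + ∑ j ∈ sᶜ, Function.update ζ₀ i z j • v j =
        (c + ∑ j ∈ (insert i s)ᶜ, ζ₀ j • v j) + z • v i := by
      intro z
      have hins : sᶜ = insert i (insert i s)ᶜ := by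
        ext j
        by_cases hj : j = i <;> simp [hj, hi]
      rw [hins, Finset.sum_insert (by simp), Function.update_self]
      have : ∑ j ∈ (insert i s)ᶜ, Function.update ζ₀ i z j • v j =
          ∑ j ∈ (insert i s)ᶜ, ζ₀ j • v j := by
        refine Finset.sum_congr rfl fun j hj => ?_
        have hji : j ≠ i := by
          rintro rfl
          simp at hj
        rw [Function.update_of_ne hji]
      rw [this]
      abel
    simp only [← ih, hsum]
    rw [lintegral_add_left measurable_const, lintegral_gaussian_enorm_add_smul_sq,
      lintegral_const, measure_univ, mul_one, Finset.sum_insert hi,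
      ENNReal.ofReal_add (sq_nonneg _) (sq_nonneg _),
      ENNReal.ofReal_add (sq_nonneg _) (Finset.sum_nonneg fun _ _ => sq_nonneg _),
      ENNReal.ofReal_pow (norm_nonneg (c + _)), ofReal_norm]
    ring

/-- The adaptive lower bound for a fixed random outcome `t` and a fixed function `g`. The values
`y` computed so far have determined the coordinates outside `s` at most. `Ψ` is a measurable
majorant of the squared error plus `b` times the cost; working with a majorant makes Fubini's theorem
available although nothing is measurable in the course of the computation. -/
theorem le_lmarginal_of_transcript {d : ℕ} {ι G : Type*} [Fintype ι] [DecidableEq ι]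
    [NormedAddCommGroup G] [InnerProductSpace ℝ G] (A : RandomizedMethod d G) (t : A.Ω)
    (S : C(Cube d, ℝ) →ₗ[ℝ] G) (g : C(Cube d, ℝ)) (h : ι → C(Cube d, ℝ))
    (hdisj : ∀ x j k, h j x ≠ 0 → h k x ≠ 0 → j = k) {b : ℝ} (hb0 : 0 ≤ b)
    (hb : ∀ j, b ≤ ‖S (h j)‖ ^ 2) {Ψ : (ι → ℝ) → ℝ≥0∞} (hΨm : Measurable Ψ)
    (hΨ : ∀ ζ : ι → ℝ, ‖S (g + ∑ j, ζ j • h j) - A.approx (g + ∑ j, ζ j • h j) t‖ₑ ^ 2 +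
      ENNReal.ofReal b * A.card (g + ∑ j, ζ j • h j) t ≤ Ψ ζ)
    (n k : ℕ) (s : Finset ι) (y : List ℝ) (ζ₀ : ι → ℝ)
    (hn : Fintype.card ι ≤ 2 * k + n) (hs : Fintype.card ι ≤ s.card + k) (hy : y.length = k)
    (htr : ∀ ζ : ι → ℝ, (∀ j ∉ s, ζ j = ζ₀ j) → A.transcript (g + ∑ j, ζ j • h j) t k = y) :
    ENNReal.ofReal (b * (Fintype.card ι / 2)) ≤
      (∫⋯∫⁻_s, Ψ ∂fun _ => gaussianReal 0 1) ζ₀ := by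
  have hupd : ∀ (z : (i : s) → ℝ), ∀ j ∉ s, Function.updateFinset ζ₀ s z j = ζ₀ j := by
    intro z j hj
    simp [Function.updateFinset, hj]
  induction n generalizing k s y ζ₀ with
  | zero =>
    -- at least half as many values as there are coordinates: the cost alone is large enough
    have hconst : ∀ z : (i : s) → ℝ,
        ENNReal.ofReal (b * (Fintype.card ι / 2)) ≤ Ψ (Function.updateFinset ζ₀ s z) := by
      intro z
      refine le_trans ?_ ((le_add_self).trans (hΨ _))
      have hlen := htr _ (hupd z)
      have hc : ((k : ℕ∞) : ℝ≥0∞) ≤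
          A.card (g + ∑ j, Function.updateFinset ζ₀ s z j • h j) t := by
        rw [ENat.toENNReal_le, ← hy, ← hlen]
        exact le_iSup (fun l => ((A.transcript _ t l).length : ℕ∞)) k
      refine le_trans ?_ (mul_le_mul_right hc _)
      rw [ENat.toENNReal_coe, ← ENNReal.ofReal_natCast k, ← ENNReal.ofReal_mul hb0]
      refine ENNReal.ofReal_le_ofReal (mul_le_mul_of_nonneg_left ?_ hb0)
      have : (Fintype.card ι : ℝ) ≤ 2 * k + (0 : ℕ) := by exact_mod_cast hn
      push_cast at this
      linarith
    calc ENNReal.ofReal (b * (Fintype.card ι / 2))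
        = ∫⁻ _, ENNReal.ofReal (b * (Fintype.card ι / 2))
          ∂(Measure.pi fun _ : s => gaussianReal 0 1) := by simp
      _ ≤ _ := lintegral_mono hconst
  | succ n ih =>
    rcases hnext : A.next t y with _ | x
    · -- the method stops, and the coordinates in `s` are unknown
      by_cases hk : Fintype.card ι ≤ 2 * k
      · exact ih k s y ζ₀ (by omega) hs hy htr hupd
      · refine le_trans ?_ (le_trans (le_lmarginal_enorm_sq (S g - A.out t y) (fun j => S (h j)) s ζ₀)
          (lintegral_mono fun z => ?_))
        · refine ENNReal.ofReal_le_ofReal ?_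
          have h1 : (s.card : ℝ) * b ≤ ∑ j ∈ s, ‖S (h j)‖ ^ 2 := by
            rw [← nsmul_eq_mul]
            exact Finset.card_nsmul_le_sum s _ b fun j _ => hb j
          refine le_trans ?_ h1
          rw [mul_comm]
          refine mul_le_mul_of_nonneg_right ?_ hb0
          have h2 : (Fintype.card ι : ℝ) ≤ s.card + k := by exact_mod_cast hs
          have h3 : (2 : ℝ) * k ≤ Fintype.card ι := by exact_mod_cast (not_le.1 hk).le
          linarith
        · refine le_trans (le_of_eq ?_) ((le_self_add).trans (hΨ _))
          have hlen := htr _ (hupd z)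
          rw [A.approx_of_next_eq_none _ t (by rw [hlen, hy]) (by rw [hlen, hnext]), hlen]
          simp only [map_add, map_sum, map_smul]
          congr 2
          abel
    · -- the next value depends on at most one coordinate
      have hstep : ∀ ζ : ι → ℝ, (∀ j ∉ s, ζ j = ζ₀ j) →
          A.transcript (g + ∑ j, ζ j • h j) t (k + 1) = y ++ [g x + ∑ j, ζ j * h j x] := by
        intro ζ hζ
        rw [RandomizedMethod.transcript, htr ζ hζ, hnext]
        simp [ContinuousMap.sum_apply]
      by_cases hex : ∃ j ∈ s, h j x ≠ 0
      · obtain ⟨i, his, hi⟩ := hex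
        rw [lmarginal_erase _ hΨm his]
        have hcard : (s.erase i).card + 1 = s.card := Finset.card_erase_add_one his
        have hbound : ∀ z : ℝ, ENNReal.ofReal (b * (Fintype.card ι / 2)) ≤
            (∫⋯∫⁻_(s.erase i), Ψ ∂fun _ => gaussianReal 0 1) (Function.update ζ₀ i z) := by
          intro z
          refine ih (k + 1) (s.erase i)
            (y ++ [g x + ∑ j, Function.update ζ₀ i z j * h j x]) _ (by omega) (by omega)
            (by simp [hy]) (fun ζ hζ => ?_) (fun w j hj => by simp [Function.updateFinset, hj])
          rw [hstep ζ]
          · congr 3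
            refine Finset.sum_congr rfl fun j _ => ?_
            by_cases hj : h j x = 0
            · simp [hj]
            · obtain rfl := hdisj x j i hj hi
              rw [hζ j (by simp)]
          · intro j hj
            have hji : j ≠ i := fun hji => hj (hji ▸ his)
            rw [hζ j (fun hj' => hj (Finset.mem_of_mem_erase hj')), Function.update_of_ne hji]
        calc ENNReal.ofReal (b * (Fintype.card ι / 2))
            = ∫⁻ _, ENNReal.ofReal (b * (Fintype.card ι / 2)) ∂(gaussianReal 0 1) := by simp
          _ ≤ _ := lintegral_mono hbound
      · push Not at hex
        refine ih (k + 1) s (y ++ [g x + ∑ j, ζ₀ j * h j x]) ζ₀ (by omega) (by omega)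
          (by simp [hy]) (fun ζ hζ => ?_) hupd
        rw [hstep ζ hζ]
        congr 3
        refine Finset.sum_congr rfl fun j _ => ?_
        by_cases hj : j ∈ s
        · rw [hex j hj, mul_zero, mul_zero]
        · rw [hζ j hj]

theorem AEMeasurable.exists_measurable_ge_lintegral_eq {α : Type*} [MeasurableSpace α]
    {μ : Measure α} {f : α → ℝ≥0∞} (hf : AEMeasurable f μ) :
    ∃ g : α → ℝ≥0∞, Measurable g ∧ (∀ x, f x ≤ g x) ∧ ∫⁻ x, g x ∂μ = ∫⁻ x, f x ∂μ := by
  classical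
  obtain ⟨s, hs, hsm, hs0⟩ := exists_measurable_superset_of_null (ae_iff.1 hf.ae_eq_mk)
  refine ⟨s.piecewise (fun _ => ∞) (hf.mk f), measurable_const.piecewise hsm hf.measurable_mk,
    fun x => ?_, lintegral_congr_ae ?_⟩
  · by_cases hx : x ∈ s
    · simp [hx]
    · rw [Set.piecewise_eq_of_notMem _ _ _ hx]
      by_contra hne
      exact hx (hs fun heq => hne heq.le)
  · filter_upwards [hf.ae_eq_mk, measure_eq_zero_iff_ae_notMem.1 hs0] with x hx hxs
    rw [Set.piecewise_eq_of_notMem _ _ _ hxs, hx]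

/-- Lower bound for the average cost of an arbitrary randomized adaptive method, for a measure that
is the law of `g + ∑ⱼ ζⱼ hⱼ` with disjointly supported `hⱼ`. -/
theorem RandomizedMethod.le_error_add_cost {d : ℕ} {ι G : Type*} [Fintype ι]
    [NormedAddCommGroup G] [InnerProductSpace ℝ G] (A : RandomizedMethod d G)
    (S : C(Cube d, ℝ) →ₗ[ℝ] G) {μ ν : Measure C(Cube d, ℝ)} [IsProbabilityMeasure μ]
    [IsProbabilityMeasure ν] (hA : A.IsAdmissible S μ) (h : ι → C(Cube d, ℝ))
    (hμ : (ν.prod (Measure.pi fun _ : ι => gaussianReal 0 1)).map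
        (fun p => p.1 + ∑ j, p.2 j • h j) = μ)
    (hdisj : ∀ x j k, h j x ≠ 0 → h k x ≠ 0 → j = k) {b : ℝ} (hb0 : 0 ≤ b)
    (hb : ∀ j, b ≤ ‖S (h j)‖ ^ 2) :
    ENNReal.ofReal (b * (Fintype.card ι / 2)) ≤
      A.avgError S μ ^ 2 + ENNReal.ofReal b * A.avgCost μ := by
  classical
  have hm1 : AEMeasurable (fun z : C(Cube d, ℝ) × A.Ω => ‖S z.1 - A.approx z.1 z.2‖ₑ ^ 2)
      (μ.prod A.P) := hA.aemeasurable_error.pow_const 2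
  have hm2 : AEMeasurable (fun z : C(Cube d, ℝ) × A.Ω =>
      ENNReal.ofReal b * (A.card z.1 z.2 : ℝ≥0∞)) (μ.prod A.P) :=
    hA.aemeasurable_card.const_mul _
  obtain ⟨Ψ, hΨm, hΨ, hint⟩ := (hm1.add hm2).exists_measurable_ge_lintegral_eq
  have hsum : A.avgError S μ ^ 2 + ENNReal.ofReal b * A.avgCost μ =
      ∫⁻ z, Ψ z ∂(μ.prod A.P) := by
    rw [hint]
    simp only [Pi.add_apply]
    rw [lintegral_add_left' hm1, lintegral_prod _ hm1,
      lintegral_const_mul'' _ hA.aemeasurable_card, lintegral_prod _ hA.aemeasurable_card, avgError,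
      avgCost, ← ENNReal.rpow_natCast, ← ENNReal.rpow_mul]
    norm_num
  have hΦ : Measurable fun p : C(Cube d, ℝ) × (ι → ℝ) => p.1 + ∑ j, p.2 j • h j :=
    Continuous.measurable (by fun_prop)
  have hfix : ∀ t : A.Ω, ENNReal.ofReal (b * (Fintype.card ι / 2)) ≤ ∫⁻ f, Ψ (f, t) ∂μ := by
    intro t
    have hΨt : Measurable fun f => Ψ (f, t) := hΨm.comp (by fun_prop)
    have hcomp : Measurable fun p : C(Cube d, ℝ) × (ι → ℝ) => Ψ (p.1 + ∑ j, p.2 j • h j, t) :=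
      hΨt.comp hΦ
    rw [← hμ, lintegral_map hΨt hΦ, lintegral_prod _ hcomp.aemeasurable]
    have hg : ∀ g : C(Cube d, ℝ), ENNReal.ofReal (b * (Fintype.card ι / 2)) ≤
        ∫⁻ ζ, Ψ (g + ∑ j, ζ j • h j, t) ∂(Measure.pi fun _ : ι => gaussianReal 0 1) := by
      intro g
      have hmeas : Measurable fun ζ : ι → ℝ => Ψ (g + ∑ j, ζ j • h j, t) :=
        hcomp.comp (measurable_const.prodMk measurable_id)
      rw [lintegral_eq_lmarginal_univ (0 : ι → ℝ)]
      exact le_lmarginal_of_transcript A t S g h hdisj hb0 hb hmeas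
        (fun ζ => hΨ (g + ∑ j, ζ j • h j, t)) (Fintype.card ι) 0 Finset.univ [] 0 (by omega)
        (by simp) rfl fun ζ _ => rfl
    calc ENNReal.ofReal (b * (Fintype.card ι / 2))
        = ∫⁻ _, ENNReal.ofReal (b * (Fintype.card ι / 2)) ∂ν := by simp
      _ ≤ _ := lintegral_mono hg
  rw [hsum, lintegral_prod_symm _ hΨm.aemeasurable]
  calc ENNReal.ofReal (b * (Fintype.card ι / 2))
      = ∫⁻ _, ENNReal.ofReal (b * (Fintype.card ι / 2)) ∂A.P := by simp
    _ ≤ _ := lintegral_mono hfix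

end LowerBound

/-! ### A white noise representation of Lévy's Brownian motion -/

section Kernel

variable {d : ℕ}

/-- The cone function of height `r` over the ball with centre `u` and radius `r`, evaluated at `x`
and weighted by `|r| ^ (-(d + 2) / 2)`, as a function of `(u, r)`; it is `0` for `r ≤ 0`. -/
noncomputable def cone (x : EuclideanSpace ℝ (Fin d)) (p : EuclideanSpace ℝ (Fin d) × ℝ) : ℝ :=
  max (p.2 - ‖x - p.1‖) 0 * √((|p.2| ^ (d + 2))⁻¹)

theorem cone_nonneg (x : EuclideanSpace ℝ (Fin d)) (p : EuclideanSpace ℝ (Fin d) × ℝ) :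
    0 ≤ cone x p :=
  mul_nonneg (le_max_right _ _) (Real.sqrt_nonneg _)

theorem cone_eq_zero {x : EuclideanSpace ℝ (Fin d)} {p : EuclideanSpace ℝ (Fin d) × ℝ}
    (h : p.2 ≤ ‖x - p.1‖) : cone x p = 0 := by
  rw [cone, max_eq_right (by linarith), zero_mul]

@[fun_prop]
theorem measurable_cone (x : EuclideanSpace ℝ (Fin d)) : Measurable (cone x) := by
  unfold cone
  fun_prop

theorem isAddHaarMeasure_volume_prod_real (d : ℕ) :
    (volume : Measure (EuclideanSpace ℝ (Fin d) × ℝ)).IsAddHaarMeasure := by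
  rw [Measure.volume_eq_prod]
  infer_instance

/-- The squared distance of `cone x` and `cone y` in `L²`. -/
noncomputable def coneDist (x y : EuclideanSpace ℝ (Fin d)) : ℝ≥0∞ :=
  ∫⁻ p, ‖cone x p - cone y p‖ₑ ^ 2

theorem coneDist_add_right (x y a : EuclideanSpace ℝ (Fin d)) :
    coneDist (x + a) (y + a) = coneDist x y := by
  have := isAddHaarMeasure_volume_prod_real d
  unfold coneDist
  rw [← lintegral_add_right_eq_self _ ((a, 0) : EuclideanSpace ℝ (Fin d) × ℝ)]
  simp [cone]

theorem coneDist_map (R : EuclideanSpace ℝ (Fin d) ≃ₗᵢ[ℝ] EuclideanSpace ℝ (Fin d))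
    (x y : EuclideanSpace ℝ (Fin d)) : coneDist (R x) (R y) = coneDist x y := by
  unfold coneDist
  have hR : MeasurePreserving (Prod.map R id) (volume : Measure (EuclideanSpace ℝ (Fin d) × ℝ))
      volume := R.measurePreserving.prod (MeasurePreserving.id _)
  rw [← hR.lintegral_comp (by fun_prop)]
  simp only [cone, Prod.map_fst, Prod.map_snd, id, ← map_sub, R.norm_map]

theorem coneDist_smul {s : ℝ} (hs : 0 < s) (x y : EuclideanSpace ℝ (Fin d)) :
    coneDist (s • x) (s • y) = ENNReal.ofReal s * coneDist x y := by
  have := isAddHaarMeasure_volume_prod_real d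
  set a : ℝ := s * √((s ^ (d + 2))⁻¹) with ha
  have hcone : ∀ z p, cone (s • z) (s • p) = a * cone (d := d) z p := by
    intro z p
    have h1 : s * p.2 - s * ‖z - p.1‖ = s * (p.2 - ‖z - p.1‖) := by ring
    have h2 : max (s * (p.2 - ‖z - p.1‖)) 0 = s * max (p.2 - ‖z - p.1‖) 0 := by
      rw [mul_max_of_nonneg _ _ hs.le, mul_zero]
    simp only [cone, Prod.smul_fst, Prod.smul_snd, ← smul_sub, norm_smul, Real.norm_eq_abs,
      abs_of_pos hs, smul_eq_mul, abs_mul, mul_pow, mul_inv, h1, h2]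
    rw [ha, Real.sqrt_mul (by positivity)]
    ring
  have hscale : ∀ f : EuclideanSpace ℝ (Fin d) × ℝ → ℝ≥0∞, Measurable f →
      ∫⁻ p, f (s • p) = ENNReal.ofReal ((s ^ (d + 1))⁻¹) * ∫⁻ p, f p := by
    intro f hf
    have h1 := Measure.map_addHaar_smul
      (volume : Measure (EuclideanSpace ℝ (Fin d) × ℝ)) hs.ne'
    rw [Module.finrank_prod, finrank_euclideanSpace_fin, Module.finrank_self,
      abs_of_pos (by positivity)] at h1
    rw [← lintegral_map hf (by fun_prop), h1, lintegral_smul_measure, smul_eq_mul]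
  have h1 := hscale (fun p => ‖cone (s • x) p - cone (s • y) p‖ₑ ^ 2) (by fun_prop)
  have hsq : ‖a‖ₑ ^ 2 = ENNReal.ofReal ((s ^ d)⁻¹) := by
    rw [ha, ← ofReal_norm, ← ENNReal.ofReal_pow (norm_nonneg _), Real.norm_eq_abs, sq_abs, mul_pow,
      Real.sq_sqrt (by positivity)]
    congr 1
    field_simp
    ring
  simp only [hcone, ← mul_sub, enorm_mul, mul_pow, hsq] at h1
  rw [lintegral_const_mul _ (by fun_prop)] at h1
  unfold coneDist
  have h2 : ENNReal.ofReal (s ^ (d + 1)) * ENNReal.ofReal ((s ^ (d + 1))⁻¹) = 1 := by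
    rw [← ENNReal.ofReal_mul (by positivity), mul_inv_cancel₀ (by positivity), ENNReal.ofReal_one]
  have h3 : ENNReal.ofReal (s ^ (d + 1)) * ENNReal.ofReal ((s ^ d)⁻¹) = ENNReal.ofReal s := by
    rw [← ENNReal.ofReal_mul (by positivity)]
    congr 1
    field_simp
    ring
  rw [← one_mul (∫⁻ p, ‖cone (s • x) p - cone (s • y) p‖ₑ ^ 2), ← h2, mul_assoc, ← h1, ← mul_assoc,
    h3]

theorem coneDist_lt_top {x y : EuclideanSpace ℝ (Fin d)} (h : ‖x - y‖ ≤ 1) :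
    coneDist x y < ∞ := by
  set V : ℝ≥0∞ := volume (Metric.ball (0 : EuclideanSpace ℝ (Fin d)) 1) with hV
  have hVtop : V ≠ ∞ := measure_ball_lt_top.ne
  -- away from the two balls of radius `r` the difference vanishes, and it is at most `min 1 r`
  have hpt : ∀ (r : ℝ) (u : EuclideanSpace ℝ (Fin d)), ‖cone x (u, r) - cone y (u, r)‖ₑ ^ 2 ≤
      (Metric.ball x r).indicator
        (fun _ => ENNReal.ofReal (min 1 (r ^ 2) * (r ^ (d + 2))⁻¹)) u +
      (Metric.ball y r).indicator
        (fun _ => ENNReal.ofReal (min 1 (r ^ 2) * (r ^ (d + 2))⁻¹)) u := by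
    intro r u
    by_cases hx : u ∈ Metric.ball x r ∨ u ∈ Metric.ball y r
    · have hr : 0 < r := by
        rcases hx with hx | hx
        · exact dist_nonneg.trans_lt (Metric.mem_ball.1 hx)
        · exact dist_nonneg.trans_lt (Metric.mem_ball.1 hx)
      have hb : ‖cone x (u, r) - cone y (u, r)‖ₑ ^ 2 ≤
          ENNReal.ofReal (min 1 (r ^ 2) * (r ^ (d + 2))⁻¹) := by
        rw [← ofReal_norm, ← ENNReal.ofReal_pow (norm_nonneg _), Real.norm_eq_abs, sq_abs, cone,
          cone, ← sub_mul, mul_pow, Real.sq_sqrt (by positivity), abs_of_pos hr]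
        refine ENNReal.ofReal_le_ofReal (mul_le_mul_of_nonneg_right ?_ (by positivity))
        dsimp only
        have h1 : |max (r - ‖x - u‖) 0 - max (r - ‖y - u‖) 0| ≤ 1 := by
          refine (abs_max_sub_max_le_abs _ _ _).trans ?_
          rw [sub_sub_sub_cancel_left]
          refine (abs_norm_sub_norm_le _ _).trans ?_
          rw [sub_sub_sub_cancel_right, norm_sub_rev]
          exact h
        have h2 : |max (r - ‖x - u‖) 0 - max (r - ‖y - u‖) 0| ≤ r := by
          have hnx := norm_nonneg (x - u)
          have hny := norm_nonneg (y - u)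
          rw [abs_le]
          constructor <;>
          rcases max_cases (r - ‖x - u‖) 0 with ⟨e1, _⟩ | ⟨e1, _⟩ <;>
          rcases max_cases (r - ‖y - u‖) 0 with ⟨e2, _⟩ | ⟨e2, _⟩ <;> rw [e1, e2] <;> linarith
        refine le_min ?_ ?_
        · rw [← sq_abs]
          exact pow_le_one₀ (abs_nonneg _) h1
        · rw [← sq_abs]
          exact pow_le_pow_left₀ (abs_nonneg _) h2 2
      rcases hx with hx | hx
      · rw [Set.indicator_of_mem hx]
        exact hb.trans le_self_add
      · rw [Set.indicator_of_mem hx (f := fun _ => ENNReal.ofReal (min 1 (r ^ 2) * (r ^ (d + 2))⁻¹))]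
        exact hb.trans le_add_self
    · push Not at hx
      simp only [Metric.mem_ball, not_lt, dist_comm u, dist_eq_norm] at hx
      rw [cone_eq_zero hx.1, cone_eq_zero hx.2]
      simp
  have hball : ∀ (z : EuclideanSpace ℝ (Fin d)) {r : ℝ}, 0 < r →
      volume (Metric.ball z r) = ENNReal.ofReal (r ^ d) * V := by
    intro z r hr
    rw [Measure.addHaar_ball_of_pos _ _ hr, finrank_euclideanSpace_fin]
  have hinner : ∀ r : ℝ, ∫⁻ u, ‖cone x (u, r) - cone y (u, r)‖ₑ ^ 2 ≤
      ENNReal.ofReal (4 * (1 + r ^ 2)⁻¹) * V := by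
    intro r
    refine (lintegral_mono (hpt r)).trans ?_
    rw [lintegral_add_left (measurable_const.indicator measurableSet_ball),
      lintegral_indicator_const measurableSet_ball, lintegral_indicator_const measurableSet_ball]
    by_cases hr : 0 < r
    · rw [hball x hr, hball y hr, ← two_mul, ← mul_assoc, ← mul_assoc]
      refine mul_le_mul_left ?_ _
      rw [← ENNReal.ofReal_ofNat 2, ← ENNReal.ofReal_mul (by positivity),
        ← ENNReal.ofReal_mul (by positivity)]
      refine ENNReal.ofReal_le_ofReal ?_
      have h1 : 2 * (min 1 (r ^ 2) * (r ^ (d + 2))⁻¹) * r ^ d = 2 * min 1 (r ^ 2) / r ^ 2 := by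
        field_simp
        ring
      rw [h1, div_le_iff₀ (by positivity)]
      have h2 : 4 * (1 + r ^ 2)⁻¹ * r ^ 2 = 4 * r ^ 2 / (1 + r ^ 2) := by ring
      rw [h2, le_div_iff₀ (by positivity)]
      rcases le_total 1 (r ^ 2) with h3 | h3
      · rw [min_eq_left h3]
        linarith
      · rw [min_eq_right h3]
        nlinarith [sq_nonneg r]
    · rw [Metric.ball_eq_empty.2 (not_lt.1 hr), Metric.ball_eq_empty.2 (not_lt.1 hr)]
      simp
  unfold coneDist
  rw [Measure.volume_eq_prod, lintegral_prod_symm _ (by fun_prop)]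
  refine (lintegral_mono hinner).trans_lt ?_
  rw [lintegral_mul_const _ (by fun_prop)]
  refine ENNReal.mul_lt_top ?_ hVtop.lt_top
  exact (integrable_inv_one_add_sq.const_mul 4).lintegral_lt_top

theorem coneDist_pos {x y : EuclideanSpace ℝ (Fin d)} (h : ‖x - y‖ = 1) : 0 < coneDist x y := by
  rw [pos_iff_ne_zero]
  intro h0
  unfold coneDist at h0
  rw [lintegral_eq_zero_iff (by fun_prop)] at h0
  set U : Set (EuclideanSpace ℝ (Fin d) × ℝ) := Metric.ball x (1 / 4) ×ˢ Set.Ioo (1 / 4) (1 / 2)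
    with hU
  have hUpos : 0 < volume U := by
    refine (Metric.isOpen_ball.prod isOpen_Ioo).measure_pos _ ⟨(x, 3 / 8), ?_, ?_⟩
    · simp
    · constructor <;> norm_num
  refine hUpos.ne' (measure_mono_null ?_ (ae_iff.1 h0))
  rintro p ⟨hp1, hp2, hp3⟩ hp0
  rw [Metric.mem_ball, dist_eq_norm, norm_sub_rev] at hp1
  have hy : cone y p = 0 := by
    refine cone_eq_zero ?_
    have h1 : ‖x - y‖ ≤ ‖x - p.1‖ + ‖y - p.1‖ := by
      rw [norm_sub_rev y]
      exact norm_sub_le_norm_sub_add_norm_sub x p.1 y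
    linarith
  have hx : 0 < cone x p := by
    have hp : 0 < p.2 := lt_trans (by norm_num) hp2
    refine mul_pos (lt_max_of_lt_left (by linarith)) (Real.sqrt_pos.2 (by positivity))
  simp [hy, hx.ne'] at hp0

/-- By invariance under motions and homogeneity under dilations, the squared `L²` distance of the
cone functions is a multiple of the Euclidean distance. -/
theorem exists_coneDist_eq (hd : 0 < d) :
    ∃ κ : ℝ, 0 < κ ∧ ∀ x y : EuclideanSpace ℝ (Fin d),
      coneDist x y = ENNReal.ofReal (κ * ‖x - y‖) := by
  set e : EuclideanSpace ℝ (Fin d) := EuclideanSpace.single ⟨0, hd⟩ 1 with he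
  have he1 : ‖e - 0‖ = 1 := by simp [he]
  have hlt := coneDist_lt_top he1.le
  have hpos := coneDist_pos he1
  refine ⟨(coneDist e 0).toReal, ENNReal.toReal_pos hpos.ne' hlt.ne, fun x y => ?_⟩
  rw [ENNReal.ofReal_mul ENNReal.toReal_nonneg, ENNReal.ofReal_toReal hlt.ne]
  rcases eq_or_ne x y with rfl | hxy
  · simp [coneDist]
  have hn : 0 < ‖x - y‖ := norm_pos_iff.2 (sub_ne_zero.2 hxy)
  have h1 : coneDist x y = coneDist (x - y) 0 := by
    rw [← coneDist_add_right (x - y) 0 y, sub_add_cancel, zero_add]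
  have h2 : ‖‖x - y‖ • e‖ = ‖x - y‖ := by
    rw [norm_smul, norm_norm]
    rw [sub_zero] at he1
    rw [he1, mul_one]
  obtain ⟨R, hR⟩ : ∃ R : EuclideanSpace ℝ (Fin d) ≃ₗᵢ[ℝ] EuclideanSpace ℝ (Fin d),
      R (‖x - y‖ • e) = x - y := ⟨_, Submodule.reflection_sub h2⟩
  rw [h1, ← hR]
  conv_lhs => rw [← map_zero R]
  rw [coneDist_map, hR]
  conv_lhs => rw [← smul_zero ‖x - y‖]
  rw [coneDist_smul hn, mul_comm]

theorem memLp_cone_sub (hd : 0 < d) (x y : EuclideanSpace ℝ (Fin d)) :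
    MemLp (fun p => cone x p - cone y p) 2 volume := by
  obtain ⟨κ, -, hκ⟩ := exists_coneDist_eq hd
  refine ⟨by fun_prop, ?_⟩
  rw [eLpNorm_lt_top_iff_lintegral_rpow_enorm_lt_top (by norm_num) (by norm_num)]
  have := hκ x y
  unfold coneDist at this
  simp [this]

/-- The white noise representation of the increment of Lévy's Brownian motion from `0` to `x`, up
to normalization. -/
noncomputable def levyVec (hd : 0 < d) (x : EuclideanSpace ℝ (Fin d)) :
    Lp ℝ 2 (volume : Measure (EuclideanSpace ℝ (Fin d) × ℝ)) :=
  (memLp_cone_sub hd x 0).toLp _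

theorem exists_norm_levyVec_sub (hd : 0 < d) :
    ∃ κ : ℝ, 0 < κ ∧ ∀ x y, ‖levyVec hd x - levyVec hd y‖ ^ 2 = κ * ‖x - y‖ := by
  obtain ⟨κ, hκ0, hκ⟩ := exists_coneDist_eq hd
  refine ⟨κ, hκ0, fun x y => ?_⟩
  have h1 : levyVec hd x - levyVec hd y = (memLp_cone_sub hd x y).toLp _ := by
    rw [levyVec, levyVec, ← MemLp.toLp_sub]
    congr 1
    ext p
    simp
  have h2 := hκ x y
  unfold coneDist at h2
  rw [h1, Lp.norm_toLp, eLpNorm_eq_lintegral_rpow_enorm_toReal (by norm_num) (by norm_num)]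
  simp only [ENNReal.toReal_ofNat, ENNReal.rpow_ofNat, h2]
  rw [← ENNReal.toReal_pow, ← ENNReal.rpow_natCast, ← ENNReal.rpow_mul]
  norm_num
  positivity

@[simp]
theorem levyVec_zero (hd : 0 < d) : levyVec hd (0 : EuclideanSpace ℝ (Fin d)) = 0 := by
  rw [← norm_eq_zero, levyVec, Lp.norm_toLp]
  simp

end Kernel

/-! ### Bump functions in the reproducing kernel Hilbert space -/

section Bumps

variable {d : ℕ}

/-- The isotropic Wiener measure is the Gaussian measure of the normalized white noise
representation. -/
theorem IsIsotropicWiener.isIsonormal (hd : 0 < d) {μ : Measure C(Cube d, ℝ)}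
    (hμ : IsIsotropicWiener μ) {κ : ℝ} (hκ0 : 0 < κ)
    (hκ : ∀ x y, ‖levyVec hd x - levyVec hd y‖ ^ 2 = κ * ‖x - y‖) :
    IsIsonormal (fun x : Cube d => (√κ)⁻¹ • levyVec hd (x : EuclideanSpace ℝ (Fin d))) μ := by
  have := hμ.isGaussian
  have hmem : ∀ x : Cube d, MemLp (fun f : C(Cube d, ℝ) => f x) 2 μ := fun x =>
    IsGaussian.memLp_dual μ (ContinuousMap.evalCLM ℝ x) 2 (by norm_num)
  have hint : ∀ x : Cube d, Integrable (fun f : C(Cube d, ℝ) => f x) μ := fun x =>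
    (hmem x).integrable (by norm_num)
  have hint2 : ∀ x y : Cube d, Integrable (fun f : C(Cube d, ℝ) => f x * f y) μ := fun x y =>
    (hmem x).integrable_mul (hmem y)
  have hcov : ∀ x y : Cube d, ∫ f, f x * f y ∂μ =
      ⟪(√κ)⁻¹ • levyVec hd (x : EuclideanSpace ℝ (Fin d)), (√κ)⁻¹ • levyVec hd (y : _)⟫ := by
    intro x y
    have hx := hκ x 0
    have hy := hκ y 0
    have hxy := hκ x y
    rw [levyVec_zero, sub_zero, sub_zero] at hx hy
    rw [norm_sub_sq_real] at hxy
    rw [hμ.covariance, real_inner_smul_left, real_inner_smul_right, ← mul_assoc, ← mul_inv,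
      Real.mul_self_sqrt hκ0.le, eq_inv_mul_iff_mul_eq₀ hκ0.ne']
    linarith
  intro c
  have hmean : ∫ f, evalComb d c f ∂μ = 0 := by
    simp only [evalComb_apply, Finsupp.sum]
    rw [integral_finsetSum _ fun x _ => (hint x).const_mul _]
    simp only [integral_const_mul, hμ.mean_zero, mul_zero, Finset.sum_const_zero]
  rw [IsGaussian.charFunDual_eq, variance_of_integral_eq_zero
    (evalComb d c).continuous.aemeasurable hmean]
  have hvar : ∫ f, (evalComb d c f) ^ 2 ∂μ = ‖Finsupp.linearCombination ℝ
      (fun x : Cube d => (√κ)⁻¹ • levyVec hd (x : EuclideanSpace ℝ (Fin d))) c‖ ^ 2 := by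
    rw [← real_inner_self_eq_norm_sq, Finsupp.linearCombination_apply]
    simp only [evalComb_apply, Finsupp.sum, sq, Finset.sum_mul_sum, sum_inner, inner_sum]
    have hint3 : ∀ x y : Cube d, Integrable (fun f : C(Cube d, ℝ) => c x * f x * (c y * f y)) μ :=
      fun x y => ((hint2 x y).const_mul (c x * c y)).congr (ae_of_all _ fun f => by ring)
    rw [integral_finsetSum _ fun x _ => integrable_finsetSum _ fun y _ => hint3 x y]
    refine Finset.sum_congr rfl fun x _ => ?_
    rw [integral_finsetSum _ fun y _ => hint3 x y]
    refine Finset.sum_congr rfl fun y _ => ?_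
    rw [real_inner_smul_left, real_inner_smul_right, ← hcov, ← integral_const_mul,
      ← integral_const_mul]
    exact integral_congr_ae (ae_of_all _ fun f => by ring)
  rw [hvar]
  have hmean' : ∫ f, ((evalComb d c f : ℝ) : ℂ) ∂μ = 0 := by
    rw [integral_complex_ofReal, hmean, Complex.ofReal_zero]
  rw [hmean', zero_mul, zero_sub, neg_div]

/-- The set of cones with centre near `z` and radius between `ρ` and `2 * ρ`. -/
def coneBox (z : EuclideanSpace ℝ (Fin d)) (ρ : ℝ) : Set (EuclideanSpace ℝ (Fin d) × ℝ) :=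
  Metric.ball z (ρ / 4) ×ˢ Set.Ioo ρ (2 * ρ)

theorem measurableSet_coneBox (z : EuclideanSpace ℝ (Fin d)) (ρ : ℝ) :
    MeasurableSet (coneBox z ρ) :=
  measurableSet_ball.prod measurableSet_Ioo

theorem volume_coneBox (z : EuclideanSpace ℝ (Fin d)) {ρ : ℝ} (hρ : 0 < ρ) :
    volume (coneBox z ρ) = ENNReal.ofReal ((ρ / 4) ^ d * ρ) *
      volume (Metric.ball (0 : EuclideanSpace ℝ (Fin d)) 1) := by
  rw [coneBox, Measure.volume_eq_prod, Measure.prod_prod, Real.volume_Ioo,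
    Measure.addHaar_ball_of_pos _ _ (by positivity), finrank_euclideanSpace_fin,
    ENNReal.ofReal_mul (by positivity)]
  rw [two_mul, add_sub_cancel_right]
  ring

theorem volume_coneBox_ne_top (z : EuclideanSpace ℝ (Fin d)) {ρ : ℝ} (hρ : 0 < ρ) :
    volume (coneBox z ρ) ≠ ∞ := by
  rw [volume_coneBox z hρ]
  exact ENNReal.mul_ne_top ENNReal.ofReal_ne_top measure_ball_lt_top.ne

theorem measureReal_coneBox (z : EuclideanSpace ℝ (Fin d)) {ρ : ℝ} (hρ : 0 < ρ) :
    volume.real (coneBox z ρ) = (ρ / 4) ^ d * ρ *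
      volume.real (Metric.ball (0 : EuclideanSpace ℝ (Fin d)) 1) := by
  rw [Measure.real, volume_coneBox z hρ, ENNReal.toReal_mul, ENNReal.toReal_ofReal (by positivity)]
  rfl

theorem cone_eq_zero_of_mem_coneBox {x z : EuclideanSpace ℝ (Fin d)} {ρ : ℝ}
    (hx : 3 * ρ ≤ ‖x - z‖) {p : EuclideanSpace ℝ (Fin d) × ℝ} (hp : p ∈ coneBox z ρ) :
    cone x p = 0 := by
  obtain ⟨h1, h2, h3⟩ := hp
  rw [Metric.mem_ball, dist_eq_norm] at h1
  refine cone_eq_zero ?_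
  have := norm_sub_le_norm_sub_add_norm_sub x p.1 z
  linarith

theorem inner_coneBox_levyVec (hd : 0 < d) {z : EuclideanSpace ℝ (Fin d)} {ρ : ℝ} (hρ : 0 < ρ)
    (hz : 3 * ρ ≤ ‖z‖) (x : EuclideanSpace ℝ (Fin d)) :
    ⟪indicatorConstLp 2 (measurableSet_coneBox z ρ) (volume_coneBox_ne_top z hρ) (1 : ℝ),
      levyVec hd x⟫ = ∫ p in coneBox z ρ, cone x p := by
  rw [L2.inner_indicatorConstLp_one]
  refine setIntegral_congr_ae (measurableSet_coneBox z ρ) ?_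
  filter_upwards [(memLp_cone_sub hd x 0).coeFn_toLp] with p hp hpz
  rw [levyVec, hp, cone_eq_zero_of_mem_coneBox (x := 0) (by simpa using hz) hpz, sub_zero]

theorem integrableOn_cone (hd : 0 < d) {z : EuclideanSpace ℝ (Fin d)} {ρ : ℝ} (hρ : 0 < ρ)
    (hz : 3 * ρ ≤ ‖z‖) (x : EuclideanSpace ℝ (Fin d)) :
    IntegrableOn (cone x) (coneBox z ρ) := by
  have : IsFiniteMeasure (volume.restrict (coneBox z ρ)) :=
    ⟨by simpa using (volume_coneBox_ne_top z hρ).lt_top⟩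
  have h1 : IntegrableOn (fun p => cone x p - cone 0 p) (coneBox z ρ) :=
    ((memLp_cone_sub hd x 0).restrict _).integrable (by norm_num)
  refine h1.congr_fun (fun p hp => ?_) (measurableSet_coneBox z ρ)
  dsimp only
  rw [cone_eq_zero_of_mem_coneBox (x := 0) (by simpa using hz) hp, sub_zero]

theorem le_setIntegral_cone (hd : 0 < d) {z : EuclideanSpace ℝ (Fin d)} {ρ : ℝ} (hρ : 0 < ρ)
    (hz : 3 * ρ ≤ ‖z‖) {x : EuclideanSpace ℝ (Fin d)} (hx : ‖x - z‖ < ρ / 4) :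
    volume.real (coneBox z ρ) * (ρ / 2 * √(((2 * ρ) ^ (d + 2))⁻¹)) ≤
      ∫ p in coneBox z ρ, cone x p := by
  have hle : ∀ p ∈ coneBox z ρ, ρ / 2 * √(((2 * ρ) ^ (d + 2))⁻¹) ≤ cone x p := by
    rintro p ⟨h1, h2, h3⟩
    rw [Metric.mem_ball, dist_eq_norm, norm_sub_rev] at h1
    have h4 := norm_sub_le_norm_sub_add_norm_sub x z p.1
    have hp : 0 < p.2 := hρ.trans h2
    unfold cone
    rw [abs_of_pos hp]
    refine mul_le_mul ((by linarith : ρ / 2 ≤ p.2 - ‖x - p.1‖).trans (le_max_left _ _)) ?_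
      (Real.sqrt_nonneg _) (le_max_right _ _)
    refine Real.sqrt_le_sqrt (inv_anti₀ (by positivity) ?_)
    exact pow_le_pow_left₀ hp.le h3.le _
  calc volume.real (coneBox z ρ) * (ρ / 2 * √(((2 * ρ) ^ (d + 2))⁻¹))
      = ∫ _ in coneBox z ρ, ρ / 2 * √(((2 * ρ) ^ (d + 2))⁻¹) := by
        rw [setIntegral_const, smul_eq_mul]
    _ ≤ _ := setIntegral_mono_on (integrableOn_const (volume_coneBox_ne_top z hρ))
        (integrableOn_cone hd hρ hz x) (measurableSet_coneBox z ρ) hle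

theorem abs_apply_le_norm (x : EuclideanSpace ℝ (Fin d)) (i : Fin d) : |x i| ≤ ‖x‖ := by
  simpa using PiLp.norm_apply_le x i

theorem le_norm_center (hd : 0 < d) (p : ℕ) (j : Fin (p ^ d)) :
    1 / (2 * (p : ℝ)) ≤ ‖((center d p j : Cube d) : EuclideanSpace ℝ (Fin d))‖ := by
  refine le_trans ?_ (abs_apply_le_norm _ ⟨0, hd⟩)
  exact (centerCoord_bounds d p j ⟨0, hd⟩).1.trans (le_abs_self _)

theorem le_norm_center_sub {p : ℕ} {j k : Fin (p ^ d)} (hjk : j ≠ k) :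
    1 / (p : ℝ) ≤ ‖((center d p j : Cube d) : EuclideanSpace ℝ (Fin d)) - center d p k‖ := by
  obtain ⟨i, hi⟩ : ∃ i, finFunctionFinEquiv.symm j i ≠ finFunctionFinEquiv.symm k i := by
    by_contra! h
    exact hjk (finFunctionFinEquiv.symm.injective (funext h))
  refine le_trans ?_ (abs_apply_le_norm _ i)
  change 1 / (p : ℝ) ≤ |centerCoord d p j i - centerCoord d p k i|
  have hp : (0 : ℝ) < p := by
    have : 0 < p := (Nat.zero_le _).trans_lt (finFunctionFinEquiv.symm j i : Fin p).2
    exact_mod_cast this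
  unfold centerCoord
  rw [← sub_div, abs_div, abs_of_pos hp, add_sub_add_right_eq_sub]
  refine div_le_div_of_nonneg_right ?_ hp.le
  have h1 : ((finFunctionFinEquiv.symm j i : Fin p) : ℤ) -
      ((finFunctionFinEquiv.symm k i : Fin p) : ℤ) ≠ 0 := by
    rw [sub_ne_zero]
    exact_mod_cast fun h => hi (Fin.ext h)
  exact_mod_cast Int.one_le_abs h1

/-- The part of the cube near the centre of a subcube, where the bump function is large. -/
theorem measureReal_near_center {p : ℕ} (hp : 0 < p) (j : Fin (p ^ d)) :
    (volume : Measure (Cube d)).real {x | ‖(x : EuclideanSpace ℝ (Fin d)) - center d p j‖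
      < 1 / (24 * p)} = (1 / (24 * (p : ℝ))) ^ d *
        volume.real (Metric.ball (0 : EuclideanSpace ℝ (Fin d)) 1) := by
  have hp' : (0 : ℝ) < p := by exact_mod_cast hp
  have himage : ((↑) '' {x : Cube d | ‖(x : EuclideanSpace ℝ (Fin d)) - center d p j‖
      < 1 / (24 * p)} : Set (EuclideanSpace ℝ (Fin d))) =
      Metric.ball (center d p j : EuclideanSpace ℝ (Fin d)) (1 / (24 * p)) := by
    ext x
    simp only [Set.mem_image, Set.mem_ofPred_eq, Metric.mem_ball, dist_eq_norm]
    constructor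
    · rintro ⟨y, hy, rfl⟩
      exact hy
    · intro hx
      refine ⟨⟨x, fun i => ?_⟩, hx, rfl⟩
      have h1 := (abs_apply_le_norm (x - (center d p j : Cube d).1) i).trans hx.le
      change |x i - centerCoord d p j i| ≤ _ at h1
      obtain ⟨h2, h3⟩ := centerCoord_bounds d p j i
      obtain ⟨h4, h5⟩ := abs_le.1 h1
      have h6 : 1 / (24 * (p : ℝ)) ≤ 1 / (2 * p) :=
        one_div_le_one_div_of_le (by positivity) (by linarith)
      constructor <;> linarith
  rw [Measure.real, volume_cube_apply, himage,
    Measure.addHaar_ball_of_pos _ _ (by positivity), finrank_euclideanSpace_fin,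
    ENNReal.toReal_mul, ENNReal.toReal_ofReal (by positivity)]
  rfl

/-- For every `p` the isotropic Wiener measure is the law of `g + ∑ⱼ ζⱼ hⱼ`, where the `p ^ d`
functions `hⱼ ≥ 0` have disjoint supports and are at least of order `p ^ (-1/2)` near the centre of
the `j`-th cube, and the `ζⱼ` are standard normal and independent of each other and of `g`. -/
theorem IsIsotropicWiener.exists_bumps (hd : 0 < d) {μ : Measure C(Cube d, ℝ)}
    (hμ : IsIsotropicWiener μ) :
    ∃ C : ℝ, 0 < C ∧ ∀ p : ℕ, 0 < p →
      ∃ (h : Fin (p ^ d) → C(Cube d, ℝ)) (ν : Measure C(Cube d, ℝ)), IsProbabilityMeasure ν ∧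
        (ν.prod (Measure.pi fun _ : Fin (p ^ d) => gaussianReal 0 1)).map
          (fun q => q.1 + ∑ j, q.2 j • h j) = μ ∧
        (∀ x j k, h j x ≠ 0 → h k x ≠ 0 → j = k) ∧ (∀ j x, 0 ≤ h j x) ∧
        ∀ j (x : Cube d), ‖(x : EuclideanSpace ℝ (Fin d)) - center d p j‖ < 1 / (24 * p) →
          √(C / p) ≤ h j x := by
  have := hμ.isGaussian
  obtain ⟨κ, hκ0, hκ⟩ := exists_norm_levyVec_sub hd
  have hiso := hμ.isIsonormal hd hκ0 hκ
  set V : ℝ := volume.real (Metric.ball (0 : EuclideanSpace ℝ (Fin d)) 1) with hV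
  have hV0 : 0 < V := ENNReal.toReal_pos (Metric.measure_ball_pos _ _ one_pos).ne'
    measure_ball_lt_top.ne
  refine ⟨V / (6 * κ * 4 ^ (d + 1) * 2 ^ (d + 2)), by positivity, fun p hp => ?_⟩
  have hp' : (0 : ℝ) < p := by exact_mod_cast hp
  set ρ : ℝ := 1 / (6 * p) with hρdef
  have hρ : 0 < ρ := by positivity
  have hρ3 : 3 * ρ = 1 / (2 * p) := by
    rw [hρdef]
    field_simp
    norm_num
  have hρ6 : 6 * ρ = 1 / p := by
    rw [hρdef]
    field_simp
  have hρ4 : ρ / 4 = 1 / (24 * p) := by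
    rw [hρdef]
    field_simp
    norm_num
  set z : Fin (p ^ d) → EuclideanSpace ℝ (Fin d) := fun j => center d p j with hz
  have hz0 : ∀ j, 3 * ρ ≤ ‖z j‖ := fun j => hρ3 ▸ le_norm_center hd p j
  have hzsub : ∀ {j k}, j ≠ k → 6 * ρ ≤ ‖z j - z k‖ := fun hjk => hρ6 ▸ le_norm_center_sub hjk
  set m : ℝ := (ρ / 4) ^ d * ρ * V with hm
  have hm0 : 0 < m := by positivity
  have hbox : ∀ j, volume.real (coneBox (z j) ρ) = m := fun j => measureReal_coneBox _ hρ
  -- the normalized indicators of the boxes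
  set F : Fin (p ^ d) → Lp ℝ 2 (volume : Measure (EuclideanSpace ℝ (Fin d) × ℝ)) := fun j =>
    (√m)⁻¹ • indicatorConstLp 2 (measurableSet_coneBox (z j) ρ)
      (volume_coneBox_ne_top (z j) hρ) (1 : ℝ) with hF
  have hFon : Orthonormal ℝ F := by
    rw [orthonormal_iff_ite]
    intro j k
    rw [hF]
    dsimp only
    rw [real_inner_smul_left, real_inner_smul_right,
      L2.real_inner_indicatorConstLp_one_indicatorConstLp_one _ _ (volume_coneBox_ne_top _ hρ)
        (volume_coneBox_ne_top _ hρ)]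
    split_ifs with hjk
    · subst hjk
      rw [Set.inter_self, hbox, ← mul_assoc, ← mul_inv, Real.mul_self_sqrt hm0.le,
        inv_mul_cancel₀ hm0.ne']
    · have hempty : coneBox (z j) ρ ∩ coneBox (z k) ρ = ∅ := by
        rw [Set.eq_empty_iff_forall_notMem]
        rintro q ⟨⟨h1, -⟩, ⟨h2, -⟩⟩
        rw [Metric.mem_ball, dist_eq_norm] at h1 h2
        have h3 := hzsub hjk
        have h4 := norm_sub_le_norm_sub_add_norm_sub (z j) q.1 (z k)
        rw [norm_sub_rev (z j) q.1] at h4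
        linarith
      rw [hempty]
      simp
  have hcont : Continuous fun x : Cube d =>
      (√κ)⁻¹ • levyVec hd (x : EuclideanSpace ℝ (Fin d)) := by
    have hc : Continuous (levyVec (d := d) hd) := by
      rw [continuous_iff_continuousAt]
      intro y
      have h1 : Tendsto (fun x => √(κ * ‖x - y‖)) (𝓝 y) (𝓝 0) := by
        have : Continuous fun x => √(κ * ‖x - y‖) := by fun_prop
        simpa using this.tendsto y
      rw [ContinuousAt, tendsto_iff_norm_sub_tendsto_zero]
      refine h1.congr fun x => ?_
      rw [← hκ, Real.sqrt_sq (norm_nonneg _)]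
    exact (hc.comp continuous_subtype_val).const_smul (√κ)⁻¹
  set h : Fin (p ^ d) → C(Cube d, ℝ) := fun j =>
    ⟨fun x => ⟪F j, (√κ)⁻¹ • levyVec hd (x : EuclideanSpace ℝ (Fin d))⟫,
      continuous_const.inner hcont⟩ with hh
  obtain ⟨ν, hν, hdec⟩ := hiso.exists_decomposition hFon h fun j x => rfl
  have hval : ∀ j (x : Cube d), h j x = (√κ)⁻¹ * ((√m)⁻¹ * ∫ q in coneBox (z j) ρ, cone x q) := by
    intro j x
    change ⟪F j, (√κ)⁻¹ • levyVec hd (x : EuclideanSpace ℝ (Fin d))⟫ = _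
    rw [real_inner_smul_right, hF]
    dsimp only
    rw [real_inner_smul_left, inner_coneBox_levyVec hd hρ (hz0 j)]
  have hzero : ∀ j (x : Cube d), h j x ≠ 0 → ‖(x : EuclideanSpace ℝ (Fin d)) - z j‖ < 3 * ρ := by
    intro j x hne
    by_contra! hx
    refine hne ?_
    rw [hval, setIntegral_eq_zero_of_forall_eq_zero fun q hq => cone_eq_zero_of_mem_coneBox hx hq,
      mul_zero, mul_zero]
  refine ⟨h, ν, hν, hdec, fun x j k hj hk => ?_, fun j x => ?_, fun j x hx => ?_⟩
  · by_contra hjk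
    have h1 := hzero j x hj
    have h2 := hzero k x hk
    have h3 := hzsub hjk
    have h4 := norm_sub_le_norm_sub_add_norm_sub (z j) x (z k)
    rw [norm_sub_rev (z j) x] at h4
    linarith
  · rw [hval]
    have : 0 ≤ ∫ q in coneBox (z j) ρ, cone x q := integral_nonneg fun q => cone_nonneg _ _
    positivity
  · rw [hval]
    rw [← hρ4] at hx
    have h1 := le_setIntegral_cone hd hρ (hz0 j) hx
    rw [hbox] at h1
    refine le_trans (le_of_eq ?_) (mul_le_mul_of_nonneg_left (mul_le_mul_of_nonneg_left h1
      (by positivity : (0 : ℝ) ≤ (√m)⁻¹)) (by positivity : (0 : ℝ) ≤ (√κ)⁻¹))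
    rw [← sq_eq_sq₀ (Real.sqrt_nonneg _) (by positivity), Real.sq_sqrt (by positivity)]
    simp only [mul_pow, inv_pow]
    rw [Real.sq_sqrt hκ0.le, Real.sq_sqrt hm0.le, Real.sq_sqrt (by positivity), hm,
      div_eq_mul_one_div _ (p : ℝ), ← hρ6, div_pow ρ]
    field_simp
    ring

end Bumps

/-! ### Lower bounds for the complexities -/

section Complexity

variable {d : ℕ}

/-- The integration problem as a linear map. -/
noncomputable def intLinear (d : ℕ) : C(Cube d, ℝ) →ₗ[ℝ] ℝ where
  toFun := IntProblem d
  map_add' f g := integral_add (f.continuous.integrable_of_hasCompactSupport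
      (HasCompactSupport.of_compactSpace f)) (g.continuous.integrable_of_hasCompactSupport
      (HasCompactSupport.of_compactSpace g))
  map_smul' a f := integral_const_mul a f

/-- The approximation problem as a linear map. -/
noncomputable def appLinear (d : ℕ) :
    C(Cube d, ℝ) →ₗ[ℝ] Lp ℝ 2 (volume : Measure (Cube d)) :=
  (ContinuousMap.toLp 2 volume ℝ : C(Cube d, ℝ) →L[ℝ] Lp ℝ 2 (volume : Measure (Cube d)))

theorem coe_appLinear (d : ℕ) : ⇑(appLinear d) = AppProblem d := rfl

theorem integrable_of_continuous_cube {E : Type*} [NormedAddCommGroup E] {f : Cube d → E}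
    (hf : Continuous f) : Integrable f :=
  hf.integrable_of_hasCompactSupport (HasCompactSupport.of_compactSpace f)

theorem norm_appProblem_sq (f : C(Cube d, ℝ)) : ‖AppProblem d f‖ ^ 2 = ∫ x, f x ^ 2 := by
  rw [← real_inner_self_eq_norm_sq, AppProblem, ContinuousMap.inner_toLp]
  simp [sq]

theorem mul_measureReal_le_integral_cube {f : Cube d → ℝ} (hf : Continuous f) (h0 : ∀ x, 0 ≤ f x)
    {s : Set (Cube d)} (hs : MeasurableSet s) {a : ℝ} (ha : ∀ x ∈ s, a ≤ f x) :
    a * volume.real s ≤ ∫ x, f x :=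
  calc a * volume.real s = ∫ _ in s, a := by rw [setIntegral_const, smul_eq_mul, mul_comm]
    _ ≤ ∫ x in s, f x := setIntegral_mono_on (integrable_const a)
        (integrable_of_continuous_cube hf).integrableOn hs ha
    _ ≤ ∫ x, f x := setIntegral_le_integral (integrable_of_continuous_cube hf) (ae_of_all _ h0)

/-- If `p ^ d` bumps of squared size `C / p ^ (d + a)` are hidden in the random function, then
`p ^ a` has to be at least of order `ε ^ (-2)` to reach the error `ε`. -/
theorem exists_le_avgComplexity {G : Type*} [NormedAddCommGroup G] (S : C(Cube d, ℝ) → G)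
    (μ : Measure C(Cube d, ℝ)) {C : ℝ} (hC : 0 < C) {a : ℕ} (ha : 0 < a)
    (h : ∀ p : ℕ, 0 < p → ∀ A : RandomizedMethod d G, A.IsAdmissible S μ →
      ENNReal.ofReal (C / (p : ℝ) ^ (d + a) * ((p : ℝ) ^ d / 2)) ≤
        A.avgError S μ ^ 2 + ENNReal.ofReal (C / (p : ℝ) ^ (d + a)) * A.avgCost μ) :
    ∃ c : ℝ, 0 < c ∧ ∀ᶠ ε in 𝓝[>] (0 : ℝ),
      ENNReal.ofReal (c * ε ^ (-2 * (d : ℝ) / a)) ≤ avgComplexity ε S μ := by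
  have ha' : (0 : ℝ) < a := by exact_mod_cast ha
  refine ⟨(C / 4) ^ ((d : ℝ) / a) / 2 ^ d / 4, by positivity, ?_⟩
  have hev : ∀ᶠ ε in 𝓝[>] (0 : ℝ), ε < √(C / 4) :=
    nhdsWithin_le_nhds (eventually_lt_nhds (by positivity))
  filter_upwards [hev, self_mem_nhdsWithin] with ε hε hε0
  rw [Set.mem_Ioi] at hε0
  have hε2 : ε ^ 2 < C / 4 := by
    rw [← Real.sq_sqrt (by positivity : 0 ≤ C / 4)]
    exact pow_lt_pow_left₀ hε hε0.le two_ne_zero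
  set X : ℝ := (C / 4 / ε ^ 2) ^ (1 / (a : ℝ)) with hX
  have hX1 : 1 ≤ X := Real.one_le_rpow (by rw [le_div_iff₀ (by positivity)]; linarith)
    (by positivity)
  set p : ℕ := ⌊X⌋₊ with hp
  have hp0 : 0 < p := Nat.floor_pos.2 hX1
  have hp0' : (0 : ℝ) < p := by exact_mod_cast hp0
  have hpX : (p : ℝ) ≤ X := Nat.floor_le (by linarith)
  have hpX2 : X / 2 ≤ p := by
    have h1 := Nat.lt_floor_add_one X
    have h2 : (1 : ℝ) ≤ p := by exact_mod_cast hp0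
    linarith
  have hXa : X ^ a = C / 4 / ε ^ 2 := by
    rw [hX, ← Real.rpow_natCast, ← Real.rpow_mul (by positivity), one_div_mul_cancel ha'.ne',
      Real.rpow_one]
  have hpa : (p : ℝ) ^ a ≤ C / 4 / ε ^ 2 := hXa ▸ pow_le_pow_left₀ hp0'.le hpX a
  refine le_iInf₂ fun A hA => ?_
  have h1 := h p hp0 A hA.1
  set b : ℝ := C / (p : ℝ) ^ (d + a) with hb
  have hb0 : 0 < b := by positivity
  have herr : A.avgError S μ ^ 2 ≤ ENNReal.ofReal (b * ((p : ℝ) ^ d / 4)) := by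
    refine (pow_le_pow_left' hA.2 2).trans ?_
    rw [← ENNReal.ofReal_pow hε0.le]
    refine ENNReal.ofReal_le_ofReal ?_
    have h2 : b * ((p : ℝ) ^ d / 4) = C / 4 / (p : ℝ) ^ a := by
      rw [hb, pow_add]
      field_simp
    rw [h2, le_div_iff₀ (by positivity), mul_comm, ← le_div_iff₀ (by positivity)]
    exact hpa
  have h3 : b * ((p : ℝ) ^ d / 2) = b * ((p : ℝ) ^ d / 4) + b * ((p : ℝ) ^ d / 4) := by ring
  rw [h3, ENNReal.ofReal_add (by positivity) (by positivity)] at h1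
  have h4 := (ENNReal.add_le_add_iff_left ENNReal.ofReal_ne_top).1 (h1.trans (add_le_add_left herr _))
  rw [ENNReal.ofReal_mul hb0.le, ENNReal.mul_le_mul_iff_right
    (ENNReal.ofReal_pos.2 hb0).ne' ENNReal.ofReal_ne_top] at h4
  refine le_trans (ENNReal.ofReal_le_ofReal ?_) h4
  have h5 : (C / 4) ^ ((d : ℝ) / a) * ε ^ (-2 * (d : ℝ) / a) = X ^ d := by
    rw [hX, ← Real.rpow_natCast, ← Real.rpow_mul (by positivity), one_div_mul_eq_div,
      Real.div_rpow (x := C / 4) (by positivity) (by positivity), ← Real.rpow_natCast ε 2,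
      ← Real.rpow_mul hε0.le]
    have h6 : ε ^ (-2 * (d : ℝ) / a) = (ε ^ (((2 : ℕ) : ℝ) * (d / a)))⁻¹ := by
      rw [← Real.rpow_neg hε0.le]
      congr 1
      push_cast
      ring
    rw [h6, ← div_eq_mul_inv]
  calc (C / 4) ^ ((d : ℝ) / a) / 2 ^ d / 4 * ε ^ (-2 * (d : ℝ) / a)
      = (X / 2) ^ d / 4 := by rw [div_pow, ← h5]; ring
    _ ≤ (p : ℝ) ^ d / 4 := by gcongr

theorem IsIsotropicWiener.exists_le_avgComplexity_int (hd : 0 < d) {μ : Measure C(Cube d, ℝ)}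
    (hμ : IsIsotropicWiener μ) :
    ∃ c : ℝ, 0 < c ∧ ∀ᶠ ε in 𝓝[>] (0 : ℝ),
      ENNReal.ofReal (c * ε ^ (-2 / (1 + 1 / (d : ℝ)))) ≤ avgComplexity ε (IntProblem d) μ := by
  have := hμ.isGaussian
  obtain ⟨C, hC, hbumps⟩ := hμ.exists_bumps hd
  set V : ℝ := volume.real (Metric.ball (0 : EuclideanSpace ℝ (Fin d)) 1) with hV
  have hV0 : 0 < V := ENNReal.toReal_pos (Metric.measure_ball_pos _ _ one_pos).ne'
    measure_ball_lt_top.ne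
  have hexp : -2 / (1 + 1 / (d : ℝ)) = -2 * (d : ℝ) / (d + 1 : ℕ) := by
    have : (0 : ℝ) < d := by exact_mod_cast hd
    push_cast
    field_simp
  rw [hexp]
  refine exists_le_avgComplexity (IntProblem d) μ (C := C * V ^ 2 / 24 ^ (2 * d)) (by positivity)
    (Nat.succ_pos d) fun p hp A hA => ?_
  have hp' : (0 : ℝ) < p := by exact_mod_cast hp
  obtain ⟨h, ν, hν, hdec, hdisj, h0, hlow⟩ := hbumps p hp
  have hS : ∀ j, C * V ^ 2 / 24 ^ (2 * d) / (p : ℝ) ^ (d + (d + 1)) ≤ ‖intLinear d (h j)‖ ^ 2 := by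
    intro j
    have h1 := mul_measureReal_le_integral_cube (h j).continuous (h0 j)
      (s := {x | ‖(x : EuclideanSpace ℝ (Fin d)) - center d p j‖ < 1 / (24 * p)})
      (measurableSet_lt (by fun_prop) measurable_const) (hlow j)
    rw [measureReal_near_center hp] at h1
    rw [Real.norm_eq_abs, sq_abs]
    refine le_trans (le_of_eq ?_) (pow_le_pow_left₀ (by positivity) h1 2)
    rw [mul_pow, Real.sq_sqrt (by positivity), div_pow, one_pow, mul_pow 24]
    field_simp
    ring
  have h2 := A.le_error_add_cost (intLinear d) hA h hdec hdisj (by positivity) hS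
  rw [Fintype.card_fin] at h2
  push_cast at h2
  exact h2

theorem IsIsotropicWiener.exists_le_avgComplexity_app (hd : 0 < d) {μ : Measure C(Cube d, ℝ)}
    (hμ : IsIsotropicWiener μ) :
    ∃ c : ℝ, 0 < c ∧ ∀ᶠ ε in 𝓝[>] (0 : ℝ),
      ENNReal.ofReal (c * ε ^ (-2 * (d : ℝ))) ≤ avgComplexity ε (AppProblem d) μ := by
  have := hμ.isGaussian
  obtain ⟨C, hC, hbumps⟩ := hμ.exists_bumps hd
  set V : ℝ := volume.real (Metric.ball (0 : EuclideanSpace ℝ (Fin d)) 1) with hV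
  have hV0 : 0 < V := ENNReal.toReal_pos (Metric.measure_ball_pos _ _ one_pos).ne'
    measure_ball_lt_top.ne
  have hexp : -2 * (d : ℝ) = -2 * (d : ℝ) / (1 : ℕ) := by simp
  rw [hexp]
  refine exists_le_avgComplexity (AppProblem d) μ (C := C * V / 24 ^ d) (by positivity)
    one_pos fun p hp A hA => ?_
  have hp' : (0 : ℝ) < p := by exact_mod_cast hp
  obtain ⟨h, ν, hν, hdec, hdisj, h0, hlow⟩ := hbumps p hp
  have hS : ∀ j, C * V / 24 ^ d / (p : ℝ) ^ (d + 1) ≤ ‖appLinear d (h j)‖ ^ 2 := by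
    intro j
    have h1 := mul_measureReal_le_integral_cube ((h j).continuous.pow 2) (fun x => sq_nonneg _)
      (s := {x | ‖(x : EuclideanSpace ℝ (Fin d)) - center d p j‖ < 1 / (24 * p)})
      (measurableSet_lt (by fun_prop) measurable_const)
      (fun x hx => pow_le_pow_left₀ (Real.sqrt_nonneg _) (hlow j x hx) 2)
    rw [measureReal_near_center hp, Real.sq_sqrt (by positivity)] at h1
    rw [coe_appLinear, norm_appProblem_sq]
    refine le_trans (le_of_eq ?_) h1
    rw [div_pow, one_pow, mul_pow 24]
    field_simp
    ring
  have h2 := A.le_error_add_cost (appLinear d) hA h hdec hdisj (by positivity) hS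
  rw [Fintype.card_fin] at h2
  push_cast at h2
  exact h2

end Complexity

/-! ### The partition of the cube -/

section Partition

variable {d : ℕ}

theorem lintegral_cube {F : EuclideanSpace ℝ (Fin d) → ℝ≥0∞} (hF : Measurable F) :
    ∫⁻ x : Cube d, F x =
      ∫⁻ y, F (WithLp.toLp 2 y) ∂(Measure.pi fun _ : Fin d => volume.restrict (Set.Icc 0 1)) := by
  have h1 : ∫⁻ x : Cube d, F x = ∫⁻ x in unitCube d, F x :=
    lintegral_subtype_comap (measurableSet_unitCube d) F
  have h2 : (WithLp.toLp 2 : (Fin d → ℝ) → EuclideanSpace ℝ (Fin d)) ⁻¹' unitCube d =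
      Set.univ.pi fun _ => Set.Icc (0 : ℝ) 1 := by
    ext y
    exact (Set.mem_univ_pi).symm
  rw [h1, ← (PiLp.volume_preserving_toLp (Fin d)).setLIntegral_comp_preimage
    (measurableSet_unitCube d) hF, h2, volume_pi, Measure.restrict_pi_pi]

instance instIsProbabilityMeasureRestrictIcc :
    IsProbabilityMeasure ((volume : Measure ℝ).restrict (Set.Icc 0 1)) :=
  ⟨by simp⟩

instance instIsProbabilityMeasureCube : IsProbabilityMeasure (volume : Measure (Cube d)) where
  measure_univ := by
    have h := lintegral_cube (d := d) (F := fun _ => 1) measurable_const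
    simpa using h

/-- The homothety that maps `D` onto the `j`-th subcube. -/
noncomputable def subcubeMap (d p : ℕ) (j : Fin (p ^ d)) (x : Cube d) : Cube d :=
  ⟨WithLp.toLp 2 fun i => centerCoord d p j i + (x.1 i - 1 / 2) / p, fun i => by
    have h0 := half_side_nonneg p
    obtain ⟨h1, h2⟩ := centerCoord_bounds d p j i
    obtain ⟨h3, h4⟩ := x.2 i
    have h5 : -(1 / (2 * (p : ℝ))) ≤ (x.1 i - 1 / 2) / p := by
      have : -(1 / (2 * (p : ℝ))) = (-1 / 2) / p := by ring
      rw [this]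
      exact div_le_div_of_nonneg_right (by linarith) (Nat.cast_nonneg p)
    have h6 : (x.1 i - 1 / 2) / p ≤ 1 / (2 * (p : ℝ)) := by
      have : 1 / (2 * (p : ℝ)) = (1 / 2) / p := by ring
      rw [this]
      exact div_le_div_of_nonneg_right (by linarith) (Nat.cast_nonneg p)
    constructor
    · change 0 ≤ centerCoord d p j i + (x.1 i - 1 / 2) / p
      linarith
    · change centerCoord d p j i + (x.1 i - 1 / 2) / p ≤ 1
      linarith⟩

theorem subcubeMap_apply (p : ℕ) (j : Fin (p ^ d)) (x : Cube d) (i : Fin d) :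
    (subcubeMap d p j x).1 i = centerCoord d p j i + (x.1 i - 1 / 2) / p := rfl

theorem center_apply (p : ℕ) (j : Fin (p ^ d)) (i : Fin d) :
    (center d p j).1 i = centerCoord d p j i := rfl

theorem measurable_subcubeMap (p : ℕ) (j : Fin (p ^ d)) : Measurable (subcubeMap d p j) := by
  unfold subcubeMap
  refine Measurable.subtype_mk (Continuous.measurable ?_)
  fun_prop

theorem volume_preimage_subcubeMap {p : ℕ} (hp : 0 < p) (j : Fin (p ^ d)) (s : Set (Cube d)) :
    volume (subcubeMap d p j ⁻¹' s) = ENNReal.ofReal ((p : ℝ) ^ d) *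
      volume (subcube d p j ∩ s) := by
  have hp' : (0 : ℝ) < p := by exact_mod_cast hp
  set a : EuclideanSpace ℝ (Fin d) :=
    WithLp.toLp 2 fun i => centerCoord d p j i - 1 / 2 / p with ha
  have himage : ((↑) '' (subcubeMap d p j ⁻¹' s) : Set (EuclideanSpace ℝ (Fin d))) =
      ((p : ℝ)⁻¹ • ·) ⁻¹' ((a + ·) ⁻¹' ((↑) '' (subcube d p j ∩ s))) := by
    ext x
    simp only [Set.mem_image, Set.mem_preimage]
    constructor
    · rintro ⟨y, hy, rfl⟩
      refine ⟨subcubeMap d p j y, ⟨fun i => ?_, hy⟩, ?_⟩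
      · rw [subcubeMap_apply, center_apply, add_sub_cancel_left, abs_div, abs_of_pos hp',
          div_le_div_iff₀ hp' (by positivity)]
        obtain ⟨h1, h2⟩ := y.2 i
        have : |y.1 i - 1 / 2| ≤ 1 / 2 := abs_le.2 ⟨by linarith, by linarith⟩
        nlinarith
      · ext i
        simp [subcubeMap_apply, ha]
        ring
    · rintro ⟨y, ⟨hy, hys⟩, hyx⟩
      have hyi : ∀ i, y.1 i = centerCoord d p j i - 1 / 2 / p + (p : ℝ)⁻¹ * x i := by
        intro i
        rw [hyx]
        simp [ha]
      have hx : x ∈ unitCube d := by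
        intro i
        have h1 := hy i
        rw [center_apply, hyi, abs_le] at h1
        have h2 : centerCoord d p j i - 1 / 2 / p + (p : ℝ)⁻¹ * x i - centerCoord d p j i =
            (x i - 1 / 2) / p := by ring
        rw [h2, div_le_div_iff₀ hp' (by positivity), ← neg_div,
          div_le_div_iff₀ (by positivity) hp'] at h1
        constructor <;> nlinarith
      refine ⟨⟨x, hx⟩, ?_, rfl⟩
      have : subcubeMap d p j ⟨x, hx⟩ = y := by
        ext i
        rw [subcubeMap_apply, hyi]
        ring
      rwa [this]
  rw [volume_cube_apply, volume_cube_apply, himage,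
    Measure.addHaar_preimage_smul _ (inv_ne_zero hp'.ne'), measure_preimage_add,
    finrank_euclideanSpace_fin, inv_pow, inv_inv, abs_of_pos (by positivity)]

theorem volume_subcube {p : ℕ} (hp : 0 < p) (j : Fin (p ^ d)) :
    ENNReal.ofReal ((p : ℝ) ^ d) * volume (subcube d p j) = 1 := by
  have h := volume_preimage_subcubeMap hp j Set.univ
  rw [Set.preimage_univ, Set.inter_univ, measure_univ] at h
  exact h.symm

theorem uniformSubcube_eq_map {p : ℕ} (hp : 0 < p) (j : Fin (p ^ d)) :
    uniformSubcube d p j = volume.map (subcubeMap d p j) := by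
  ext s hs
  rw [Measure.map_apply (measurable_subcubeMap p j) hs, volume_preimage_subcubeMap hp,
    uniformSubcube, cond_apply (measurableSet_subcube d p j)]
  congr 1
  have h := volume_subcube (d := d) hp j
  rw [mul_comm] at h
  exact (ENNReal.eq_inv_of_mul_eq_one_left (by rwa [mul_comm] at h)).symm

theorem restrict_subcube_eq {p : ℕ} (hp : 0 < p) (j : Fin (p ^ d)) :
    (volume : Measure (Cube d)).restrict (subcube d p j) =
      ENNReal.ofReal (((p : ℝ) ^ d)⁻¹) • volume.map (subcubeMap d p j) := by
  have hp' : (0 : ℝ) < p := by exact_mod_cast hp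
  ext s hs
  rw [Measure.restrict_apply hs, Measure.smul_apply,
    Measure.map_apply (measurable_subcubeMap p j) hs, volume_preimage_subcubeMap hp, smul_eq_mul,
    ← mul_assoc, ← ENNReal.ofReal_mul (by positivity), inv_mul_cancel₀ (by positivity),
    ENNReal.ofReal_one, one_mul, Set.inter_comm]

theorem exists_mem_subcube {p : ℕ} (hp : 0 < p) (x : Cube d) : ∃ j, x ∈ subcube d p j := by
  have hp' : (0 : ℝ) < p := by exact_mod_cast hp
  set k : Fin d → Fin p := fun i => ⟨min ⌊(p : ℝ) * x.1 i⌋₊ (p - 1), by omega⟩ with hk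
  refine ⟨finFunctionFinEquiv k, fun i => ?_⟩
  rw [center_apply, centerCoord, Equiv.symm_apply_apply]
  have h0 : 0 ≤ (p : ℝ) * x.1 i := mul_nonneg hp'.le (x.2 i).1
  have h1 : ((k i : ℕ) : ℝ) ≤ p * x.1 i :=
    (Nat.cast_le.2 (min_le_left _ _)).trans (Nat.floor_le h0)
  have h2 : p * x.1 i ≤ ((k i : ℕ) : ℝ) + 1 := by
    have h3 : (k i : ℕ) = min ⌊(p : ℝ) * x.1 i⌋₊ (p - 1) := rfl
    rcases min_choice ⌊(p : ℝ) * x.1 i⌋₊ (p - 1) with h4 | h4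
    · rw [h3, h4]
      exact (Nat.lt_floor_add_one _).le
    · rw [h3, h4, Nat.cast_sub (by omega)]
      have := (x.2 i).2
      push_cast
      nlinarith
  have h3 : x.1 i - (((k i : ℕ) : ℝ) + 1 / 2) / p = (p * x.1 i - (k i : ℕ) - 1 / 2) / p := by
    field_simp
    ring
  rw [h3, abs_div, abs_of_pos hp', div_le_div_iff₀ hp' (by positivity)]
  have : |p * x.1 i - (k i : ℕ) - 1 / 2| ≤ 1 / 2 := abs_le.2 ⟨by linarith, by linarith⟩
  nlinarith

/-- The subcubes cover `D`, and their volumes add up to `1`; hence they overlap in null sets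
only. -/
theorem sum_restrict_subcube {p : ℕ} (hp : 0 < p) :
    Measure.sum (fun j => (volume : Measure (Cube d)).restrict (subcube d p j)) = volume := by
  symm
  refine Measure.eq_of_le_of_measure_univ_eq (Measure.le_intro fun s hs _ => ?_) ?_
  · rw [Measure.sum_apply _ hs, tsum_fintype]
    calc volume s ≤ volume (⋃ j, s ∩ subcube d p j) := by
          refine measure_mono fun x hx => ?_
          obtain ⟨j, hj⟩ := exists_mem_subcube hp x
          exact Set.mem_iUnion.2 ⟨j, hx, hj⟩
      _ ≤ ∑ j, volume (s ∩ subcube d p j) := measure_iUnion_fintype_le _ _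
      _ = ∑ j, (volume.restrict (subcube d p j)) s :=
          Finset.sum_congr rfl fun j _ => (Measure.restrict_apply hs).symm
  · rw [Measure.sum_apply _ MeasurableSet.univ, tsum_fintype, measure_univ]
    simp only [Measure.restrict_apply_univ]
    have h : ∀ j : Fin (p ^ d), volume (subcube d p j) = (ENNReal.ofReal ((p : ℝ) ^ d))⁻¹ :=
      fun j => ENNReal.eq_inv_of_mul_eq_one_left (by rw [mul_comm, volume_subcube hp])
    have hp' : (0 : ℝ) < p := by exact_mod_cast hp
    simp only [h, Finset.sum_const, Finset.card_univ, Fintype.card_fin, nsmul_eq_mul]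
    rw [← ENNReal.ofReal_natCast, Nat.cast_pow,
      ENNReal.mul_inv_cancel (ENNReal.ofReal_pos.2 (by positivity)).ne' ENNReal.ofReal_ne_top]

theorem volume_subcube_inter {p : ℕ} (hp : 0 < p) {j k : Fin (p ^ d)} (hjk : j ≠ k) :
    volume (subcube d p j ∩ subcube d p k) = 0 := by
  set s := subcube d p j ∩ subcube d p k with hs
  have hsm : MeasurableSet s := (measurableSet_subcube d p j).inter (measurableSet_subcube d p k)
  have h1 : ∑ i, volume (s ∩ subcube d p i) = volume s := by
    conv_rhs => rw [← sum_restrict_subcube hp, Measure.sum_apply _ hsm, tsum_fintype]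
    exact Finset.sum_congr rfl fun i _ => (Measure.restrict_apply hsm).symm
  have hj : s ∩ subcube d p j = s := Set.inter_eq_left.2 Set.inter_subset_left
  have hk : s ∩ subcube d p k = s := Set.inter_eq_left.2 Set.inter_subset_right
  have h2 : volume s + volume s ≤ volume s := by
    calc volume s + volume s = ∑ i ∈ {j, k}, volume (s ∩ subcube d p i) := by
          rw [Finset.sum_pair hjk, hj, hk]
      _ ≤ ∑ i, volume (s ∩ subcube d p i) :=
          Finset.sum_le_sum_of_subset (Finset.subset_univ _)
      _ = volume s := h1
  by_contra h0
  exact absurd h2 (not_le.2 (ENNReal.lt_add_right (measure_ne_top _ _) h0))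

theorem lintegral_eq_sum_subcube {p : ℕ} (hp : 0 < p) (F : Cube d → ℝ≥0∞) :
    ∫⁻ x, F x = ∑ j, ∫⁻ x in subcube d p j, F x := by
  conv_lhs => rw [← sum_restrict_subcube hp]
  rw [lintegral_sum_measure, tsum_fintype]

theorem norm_subcubeMap_sub {p : ℕ} (j : Fin (p ^ d)) (x y : Cube d) :
    ‖((subcubeMap d p j x : Cube d) : EuclideanSpace ℝ (Fin d)) - subcubeMap d p j y‖ =
      ‖(x : EuclideanSpace ℝ (Fin d)) - y‖ / p := by
  have h : ((subcubeMap d p j x : Cube d) : EuclideanSpace ℝ (Fin d)) - subcubeMap d p j y =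
      (p : ℝ)⁻¹ • ((x : EuclideanSpace ℝ (Fin d)) - y) := by
    ext i
    simp [subcubeMap_apply]
    ring
  rw [h, norm_smul, norm_inv, Real.norm_natCast, inv_mul_eq_div]

/-- The centre of `D`. -/
noncomputable def cubeCenter (d : ℕ) : Cube d :=
  ⟨WithLp.toLp 2 fun _ => 1 / 2, fun i => by constructor <;> norm_num⟩

theorem subcubeMap_cubeCenter (p : ℕ) (j : Fin (p ^ d)) :
    subcubeMap d p j (cubeCenter d) = center d p j := by
  ext i
  rw [subcubeMap_apply, center_apply]
  simp [cubeCenter]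

/-- The map `u ↦ |2u - 1|` folds `[0,1]` twice onto itself. -/
theorem measurePreserving_abs_two_mul_sub_one :
    MeasurePreserving (fun u : ℝ => |2 * u - 1|) (volume.restrict (Set.Icc 0 1))
      (volume.restrict (Set.Icc 0 1)) := by
  have hm : Measurable fun u : ℝ => |2 * u - 1| := by fun_prop
  refine ⟨hm, ?_⟩
  have := Measure.isProbabilityMeasure_map
    (μ := (volume : Measure ℝ).restrict (Set.Icc 0 1)) hm.aemeasurable
  refine Measure.ext_of_Iic _ _ fun a => ?_
  rw [Measure.map_apply hm measurableSet_Iic, Measure.restrict_apply (hm measurableSet_Iic),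
    Measure.restrict_apply measurableSet_Iic]
  rcases lt_or_ge a 0 with ha | ha
  · have h1 : (fun u : ℝ => |2 * u - 1|) ⁻¹' Set.Iic a ∩ Set.Icc 0 1 = ∅ := by
      ext u
      simp only [Set.mem_inter_iff, Set.mem_preimage, Set.mem_Iic, Set.mem_empty_iff_false,
        iff_false, not_and]
      intro h
      exact absurd (abs_nonneg (2 * u - 1)) (by linarith)
    have h2 : Set.Iic a ∩ Set.Icc 0 1 = ∅ := by
      ext u
      simp only [Set.mem_inter_iff, Set.mem_Iic, Set.mem_Icc, Set.mem_empty_iff_false, iff_false]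
      intro h
      linarith [h.1, h.2.1]
    rw [h1, h2]
  · have h1 : (fun u : ℝ => |2 * u - 1|) ⁻¹' Set.Iic a ∩ Set.Icc 0 1 =
        Set.Icc ((1 - min a 1) / 2) ((1 + min a 1) / 2) := by
      ext u
      simp only [Set.mem_inter_iff, Set.mem_preimage, Set.mem_Iic, Set.mem_Icc, abs_le]
      rcases min_cases a 1 with ⟨e, _⟩ | ⟨e, _⟩ <;> rw [e] <;> constructor
      · rintro ⟨⟨_, _⟩, _, _⟩
        constructor <;> linarith
      · rintro ⟨_, _⟩
        refine ⟨⟨?_, ?_⟩, ?_, ?_⟩ <;> linarith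
      · rintro ⟨⟨_, _⟩, _, _⟩
        constructor <;> linarith
      · rintro ⟨_, _⟩
        refine ⟨⟨?_, ?_⟩, ?_, ?_⟩ <;> linarith
    have h2 : Set.Iic a ∩ Set.Icc 0 1 = Set.Icc 0 (min a 1) := by
      ext u
      simp only [Set.mem_inter_iff, Set.mem_Iic, Set.mem_Icc, le_min_iff]
      tauto
    rw [h1, h2, Real.volume_Icc, Real.volume_Icc]
    congr 1
    ring

theorem lintegral_norm_sub_cubeCenter :
    ∫⁻ x : Cube d, ENNReal.ofReal ‖(x : EuclideanSpace ℝ (Fin d)) - cubeCenter d‖ =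
      ENNReal.ofReal (appConst d) := by
  have h1 := measurePreserving_pi (fun _ : Fin d => (volume : Measure ℝ).restrict (Set.Icc 0 1))
    (fun _ : Fin d => (volume : Measure ℝ).restrict (Set.Icc 0 1))
    fun _ => measurePreserving_abs_two_mul_sub_one
  have h2 : ∀ y : Fin d → ℝ, ‖WithLp.toLp 2 y - (cubeCenter d : EuclideanSpace ℝ (Fin d))‖ =
      ‖(WithLp.toLp 2 fun i => |2 * y i - 1| : EuclideanSpace ℝ (Fin d))‖ / 2 := by
    intro y
    rw [eq_div_iff two_ne_zero, mul_comm, ← abs_of_pos (two_pos (α := ℝ)), ← Real.norm_eq_abs,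
      ← norm_smul, EuclideanSpace.norm_eq, EuclideanSpace.norm_eq]
    congr 1
    refine Finset.sum_congr rfl fun i _ => ?_
    simp only [cubeCenter, PiLp.smul_apply, PiLp.sub_apply, smul_eq_mul, Real.norm_eq_abs, sq_abs]
    ring
  have hint : Integrable fun x : Cube d => ‖(x : EuclideanSpace ℝ (Fin d))‖ / 2 :=
    integrable_of_continuous_cube (by fun_prop)
  rw [appConst, ofReal_integral_eq_lintegral_ofReal hint (ae_of_all _ fun x => by positivity),
    lintegral_cube (F := fun x => ENNReal.ofReal ‖x - (cubeCenter d).1‖) (by fun_prop),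
    lintegral_cube (F := fun x => ENNReal.ofReal (‖x‖ / 2)) (by fun_prop)]
  simp only [h2]
  exact h1.lintegral_comp (f := fun y : Fin d → ℝ =>
    ENNReal.ofReal (‖(WithLp.toLp 2 y : EuclideanSpace ℝ (Fin d))‖ / 2)) (by fun_prop)

end Partition

/-! ### Cost and error of the two methods -/

section Methods

variable {d : ℕ}

theorem RandomizedMethod.transcript_of_nonadaptive {G : Type*} (A : RandomizedMethod d G)
    (f : C(Cube d, ℝ)) (t : A.Ω) {n : ℕ} (q : Fin n → Cube d)
    (h : ∀ y, A.next t y = if h : y.length < n then some (q ⟨y.length, h⟩) else none) {k : ℕ}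
    (hk : k ≤ n) : A.transcript f t k = (List.ofFn fun i => f (q i)).take k := by
  induction k with
  | zero => simp [transcript]
  | succ k ih =>
    have hlen : ((List.ofFn fun i => f (q i)).take k).length = k := by
      rw [List.length_take, List.length_ofFn]
      omega
    rw [transcript, ih (by omega), h, dif_pos (by omega)]
    have hk' : k < (List.ofFn fun i => f (q i)).length := by
      rw [List.length_ofFn]
      omega
    rw [← List.take_append_getElem hk']
    simp only [List.getElem_ofFn]
    congr 5

theorem RandomizedMethod.card_of_nonadaptive {G : Type*} (A : RandomizedMethod d G)
    (f : C(Cube d, ℝ)) (t : A.Ω) {n : ℕ} (q : Fin n → Cube d)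
    (h : ∀ y, A.next t y = if h : y.length < n then some (q ⟨y.length, h⟩) else none) :
    A.card f t = n := by
  have htr := A.transcript_of_nonadaptive f t q h le_rfl
  rw [List.take_of_length_le (by simp)] at htr
  exact A.card_of_next_eq_none f t (by simp [htr]) (by rw [h, dif_neg (by simp [htr])])

theorem RandomizedMethod.approx_of_nonadaptive {G : Type*} (A : RandomizedMethod d G)
    (f : C(Cube d, ℝ)) (t : A.Ω) {n : ℕ} (q : Fin n → Cube d)
    (h : ∀ y, A.next t y = if h : y.length < n then some (q ⟨y.length, h⟩) else none) :
    A.approx f t = A.out t (List.ofFn fun i => f (q i)) := by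
  have htr := A.transcript_of_nonadaptive f t q h le_rfl
  rw [List.take_of_length_le (by simp)] at htr
  rw [A.approx_of_next_eq_none f t (k := n) (by simp [htr]) (by rw [h, dif_neg (by simp [htr])]), htr]

theorem card_haberMethod (p : ℕ) (f : C(Cube d, ℝ)) (t : (haberMethod d p).Ω) :
    (haberMethod d p).card f t = (p ^ d : ℕ) :=
  RandomizedMethod.card_of_nonadaptive (haberMethod d p) f t (q := t) fun _ => rfl

theorem approx_haberMethod (p : ℕ) (f : C(Cube d, ℝ)) (t : Fin (p ^ d) → Cube d) :
    (haberMethod d p).approx f t = 1 / ((p ^ d : ℕ) : ℝ) * ∑ j, f (t j) := by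
  rw [RandomizedMethod.approx_of_nonadaptive (haberMethod d p) f t (q := t) fun _ => rfl]
  simp only [haberMethod, List.sum_ofFn]

theorem card_piecewiseConstMethod (p : ℕ) (f : C(Cube d, ℝ)) (t : Unit) :
    (piecewiseConstMethod d p).card f t = (p ^ d : ℕ) :=
  RandomizedMethod.card_of_nonadaptive (piecewiseConstMethod d p) f t (q := center d p) fun _ => rfl

theorem approx_piecewiseConstMethod (p : ℕ) (f : C(Cube d, ℝ)) (t : Unit) :
    (piecewiseConstMethod d p).approx f t = ∑ j : Fin (p ^ d), f (center d p j) •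
      indicatorConstLp 2 (measurableSet_subcube d p j)
        (measure_ne_top volume (subcube d p j)) (1 : ℝ) := by
  rw [RandomizedMethod.approx_of_nonadaptive (piecewiseConstMethod d p) f t (q := center d p)
    fun _ => rfl]
  simp only [piecewiseConstMethod]
  refine Finset.sum_congr rfl fun j _ => ?_
  congr 1
  simp [List.getD]

theorem isProbabilityMeasure_of_isIsotropicWiener {μ : Measure C(Cube d, ℝ)}
    (hμ : IsIsotropicWiener μ) : IsProbabilityMeasure μ :=
  have := hμ.isGaussian
  inferInstance

theorem avgCost_haberMethod (p : ℕ) (μ : Measure C(Cube d, ℝ)) [IsProbabilityMeasure μ] :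
    (haberMethod d p).avgCost μ = ((p ^ d : ℕ) : ℝ≥0∞) := by
  unfold RandomizedMethod.avgCost
  simp only [card_haberMethod, lintegral_const, measure_univ, mul_one]
  simp

theorem avgCost_piecewiseConstMethod (p : ℕ) (μ : Measure C(Cube d, ℝ)) [IsProbabilityMeasure μ] :
    (piecewiseConstMethod d p).avgCost μ = ((p ^ d : ℕ) : ℝ≥0∞) := by
  unfold RandomizedMethod.avgCost
  have h : ∀ f t, (piecewiseConstMethod d p).card f t = (p ^ d : ℕ) := fun f t =>
    card_piecewiseConstMethod p f t
  simp only [h, lintegral_const, measure_univ, mul_one]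
  simp

theorem continuous_intProblem : Continuous (IntProblem d) := by
  have h : Continuous fun f : C(Cube d, ℝ) =>
      ∫ x, ContinuousMap.toLp (E := ℝ) 1 volume ℝ f x :=
    continuous_integral.comp (ContinuousMap.toLp (E := ℝ) 1 volume ℝ).continuous
  refine h.congr fun f => integral_congr_ae ?_
  exact ContinuousMap.coeFn_toLp volume f

theorem isAdmissible_haberMethod (p : ℕ) (μ : Measure C(Cube d, ℝ)) :
    (haberMethod d p).IsAdmissible (IntProblem d) μ where
  aemeasurable_card := by
    simp only [card_haberMethod]
    exact aemeasurable_const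
  aemeasurable_error := by
    have h : Continuous fun z : C(Cube d, ℝ) × (Fin (p ^ d) → Cube d) =>
        ‖IntProblem d z.1 - 1 / ((p ^ d : ℕ) : ℝ) * ∑ j, z.1 (z.2 j)‖ₑ := by
      have := continuous_intProblem (d := d)
      fun_prop
    refine h.measurable.aemeasurable.congr (ae_of_all _ fun z => ?_)
    exact congrArg (fun w => ‖IntProblem d z.1 - w‖ₑ) (approx_haberMethod p z.1 z.2).symm

theorem isAdmissible_piecewiseConstMethod (p : ℕ) (μ : Measure C(Cube d, ℝ)) :
    (piecewiseConstMethod d p).IsAdmissible (AppProblem d) μ where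
  aemeasurable_card := by
    have h : ∀ f t, (piecewiseConstMethod d p).card f t = (p ^ d : ℕ) := fun f t =>
      card_piecewiseConstMethod p f t
    simp only [h]
    exact aemeasurable_const
  aemeasurable_error := by
    have h : Continuous fun f : C(Cube d, ℝ) =>
        ‖AppProblem d f - ∑ j : Fin (p ^ d), f (center d p j) •
          indicatorConstLp 2 (measurableSet_subcube d p j)
            (measure_ne_top volume (subcube d p j)) (1 : ℝ)‖ₑ := by
      have : Continuous (AppProblem d) := (ContinuousMap.toLp 2 volume ℝ).continuous
      fun_prop
    refine (h.measurable.comp measurable_fst).aemeasurable.congr (ae_of_all _ fun z => ?_)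
    exact congrArg (fun w => ‖AppProblem d z.1 - w‖ₑ) (approx_piecewiseConstMethod p z.1 z.2).symm

theorem IsIsotropicWiener.lintegral_increment_sq {μ : Measure C(Cube d, ℝ)}
    (hμ : IsIsotropicWiener μ) (x y : Cube d) :
    ∫⁻ f, ‖f x - f y‖ₑ ^ 2 ∂μ =
      ENNReal.ofReal ‖(x : EuclideanSpace ℝ (Fin d)) - y‖ := by
  have := hμ.isGaussian
  have hmem : ∀ x : Cube d, MemLp (fun f : C(Cube d, ℝ) => f x) 2 μ := fun x =>
    IsGaussian.memLp_dual μ (ContinuousMap.evalCLM ℝ x) 2 (by norm_num)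
  have hint : ∀ x y : Cube d, Integrable (fun f : C(Cube d, ℝ) => f x * f y) μ := fun x y =>
    (hmem x).integrable_mul (hmem y)
  have hsq : Integrable (fun f : C(Cube d, ℝ) => (f x - f y) ^ 2) μ :=
    ((hmem x).sub (hmem y)).integrable_sq
  have hval : ∫ f, (f x - f y) ^ 2 ∂μ = ‖(x : EuclideanSpace ℝ (Fin d)) - y‖ := by
    have hexp : ∀ f : C(Cube d, ℝ), (f x - f y) ^ 2 = f x * f x - 2 * (f x * f y) + f y * f y :=
      fun f => by ring
    have hi : Integrable (fun f : C(Cube d, ℝ) => f x * f x - 2 * (f x * f y)) μ :=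
      (hint x x).sub ((hint x y).const_mul 2)
    simp only [hexp]
    rw [integral_add hi (hint y y), integral_sub (hint x x) ((hint x y).const_mul 2),
      integral_const_mul, hμ.covariance, hμ.covariance, hμ.covariance, sub_self, sub_self,
      norm_zero]
    ring
  rw [← hval, ofReal_integral_eq_lintegral_ofReal hsq (ae_of_all _ fun f => sq_nonneg _)]
  refine lintegral_congr fun f => ?_
  rw [← ofReal_norm, ← ENNReal.ofReal_pow (norm_nonneg _), Real.norm_eq_abs, sq_abs]

theorem memLp_continuousMap (U : Measure (Cube d)) [IsFiniteMeasure U] (f : C(Cube d, ℝ)) :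
    MemLp f 2 U :=
  (f.continuous.memLp_of_hasCompactSupport (HasCompactSupport.of_compactSpace f))

/-- The variance is half the mean square difference of two independent copies. -/
theorem ofReal_variance_eq_lintegral_prod (U : Measure (Cube d)) [IsProbabilityMeasure U]
    (f : C(Cube d, ℝ)) :
    ENNReal.ofReal (2 * Var[f; U]) = ∫⁻ z, ‖f z.1 - f z.2‖ₑ ^ 2 ∂(U.prod U) := by
  have hf := memLp_continuousMap U f
  have h1 : Integrable f U := hf.integrable (by norm_num)
  have h2 : Integrable (fun x => f x ^ 2) U := hf.integrable_sq
  have hcont : Continuous fun z : Cube d × Cube d => (f z.1 - f z.2) ^ 2 := by fun_prop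
  have hint : Integrable (fun z : Cube d × Cube d => (f z.1 - f z.2) ^ 2) (U.prod U) :=
    hcont.integrable_of_hasCompactSupport (HasCompactSupport.of_compactSpace _)
  have hinner : ∀ x, ∫ y, (f x - f y) ^ 2 ∂U =
      f x ^ 2 - 2 * (∫ y, f y ∂U) * f x + ∫ y, f y ^ 2 ∂U := by
    intro x
    have hexp : ∀ y, (f x - f y) ^ 2 = (f x ^ 2 - 2 * f x * f y) + f y ^ 2 := fun y => by ring
    have hi : Integrable (fun y => f x ^ 2 - 2 * f x * f y) U :=
      (integrable_const _).sub (h1.const_mul _)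
    simp only [hexp]
    rw [integral_add hi h2, integral_sub (integrable_const _) (h1.const_mul _),
      integral_const_mul, integral_const, probReal_univ, one_smul]
    ring
  have hval : ∫ z, (f z.1 - f z.2) ^ 2 ∂(U.prod U) = 2 * Var[f; U] := by
    rw [integral_prod _ hint]
    simp only [hinner]
    have hi : Integrable (fun x => f x ^ 2 - 2 * (∫ y, f y ∂U) * f x) U :=
      h2.sub (h1.const_mul _)
    rw [integral_add hi (integrable_const _), integral_sub h2 (h1.const_mul _),
      integral_const_mul, integral_const, probReal_univ, one_smul, variance_eq_sub hf]
    simp only [Pi.pow_apply]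
    ring
  rw [← hval, ofReal_integral_eq_lintegral_ofReal hint (ae_of_all _ fun z => sq_nonneg _)]
  refine lintegral_congr fun z => ?_
  rw [← ofReal_norm, ← ENNReal.ofReal_pow (norm_nonneg _), Real.norm_eq_abs, sq_abs]

theorem lintegral_prod_uniformSubcube {p : ℕ} (hp : 0 < p) (j : Fin (p ^ d)) :
    ∫⁻ z : Cube d × Cube d, ENNReal.ofReal ‖(z.1 : EuclideanSpace ℝ (Fin d)) - z.2‖
      ∂((uniformSubcube d p j).prod (uniformSubcube d p j)) =
      ENNReal.ofReal (2 * intConst d / p) := by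
  have hp' : (0 : ℝ) < p := by exact_mod_cast hp
  have hm := measurable_subcubeMap (d := d) p j
  have hint : Integrable fun z : Cube d × Cube d =>
      ‖(z.2 : EuclideanSpace ℝ (Fin d)) - z.1‖ / 2 := by
    have : Continuous fun z : Cube d × Cube d =>
      ‖(z.2 : EuclideanSpace ℝ (Fin d)) - z.1‖ / 2 := by fun_prop
    rw [Measure.volume_eq_prod]
    exact this.integrable_of_hasCompactSupport (HasCompactSupport.of_compactSpace _)
  have hconst : intConst d = ∫ z : Cube d × Cube d,
      ‖(z.2 : EuclideanSpace ℝ (Fin d)) - z.1‖ / 2 := by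
    rw [Measure.volume_eq_prod] at hint ⊢
    rw [integral_prod _ hint, intConst]
  have hmul : 2 * intConst d / p = ∫ z : Cube d × Cube d,
      ‖(z.2 : EuclideanSpace ℝ (Fin d)) - z.1‖ / 2 * (2 / p) := by
    rw [integral_mul_const, ← hconst]
    ring
  rw [hmul, ofReal_integral_eq_lintegral_ofReal (hint.mul_const _)
    (ae_of_all _ fun z => by positivity), uniformSubcube_eq_map hp,
    Measure.map_prod_map _ _ hm hm, lintegral_map (by fun_prop) (hm.prodMap hm),
    Measure.volume_eq_prod]
  refine lintegral_congr fun z => ?_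
  rw [Prod.map_fst, Prod.map_snd, norm_subcubeMap_sub, norm_sub_rev]
  congr 1
  ring

theorem integral_uniformSubcube_sum {p : ℕ} (hp : 0 < p) (f : C(Cube d, ℝ)) :
    ∑ j : Fin (p ^ d), ∫ x, f x ∂(uniformSubcube d p j) = ((p ^ d : ℕ) : ℝ) * IntProblem d f := by
  have hp' : (0 : ℝ) < p := by exact_mod_cast hp
  have hint : Integrable f volume := integrable_of_continuous_cube f.continuous
  have h1 : IntProblem d f = ∑ j : Fin (p ^ d), ∫ x in subcube d p j, f x := by
    unfold IntProblem
    conv_lhs => rw [← sum_restrict_subcube hp]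
    rw [Measure.sum_fintype, integral_finsetSum_measure]
    exact fun j _ => hint.restrict
  rw [h1, Finset.mul_sum]
  refine Finset.sum_congr rfl fun j _ => ?_
  rw [restrict_subcube_eq hp, ← uniformSubcube_eq_map hp, integral_smul_measure,
    ENNReal.toReal_ofReal (by positivity), smul_eq_mul, ← mul_assoc, Nat.cast_pow,
    mul_inv_cancel₀ (by positivity), one_mul]

/-- For fixed `f`, the mean square error of stratified sampling is the sum of the variances within
the strata. -/
theorem lintegral_haberMethod_error {p : ℕ} (hp : 0 < p) (f : C(Cube d, ℝ)) :
    ∫⁻ t, ‖IntProblem d f - (haberMethod d p).approx f t‖ₑ ^ 2 ∂(haberMethod d p).P =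
      ENNReal.ofReal (1 / (2 * ((p ^ d : ℕ) : ℝ) ^ 2)) * ∑ j : Fin (p ^ d),
        ∫⁻ z, ‖f z.1 - f z.2‖ₑ ^ 2 ∂((uniformSubcube d p j).prod (uniformSubcube d p j)) := by
  have hp' : (0 : ℝ) < p := by exact_mod_cast hp
  set n : ℝ := ((p ^ d : ℕ) : ℝ) with hn
  have hn0 : 0 < n := by rw [hn, Nat.cast_pow]; positivity
  set X : Fin (p ^ d) → Cube d → ℝ := fun _ x => 1 / n * f x with hX
  have hmem : ∀ j, MemLp (X j) 2 (uniformSubcube d p j) := fun j =>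
    (memLp_continuousMap _ f).const_mul _
  have hmem' : ∀ j, MemLp (fun t : Fin (p ^ d) → Cube d => X j (t j)) 2
      (Measure.pi (uniformSubcube d p)) := fun j =>
    (hmem j).comp_measurePreserving (measurePreserving_eval _ j)
  set Y : (Fin (p ^ d) → Cube d) → ℝ := ∑ j, fun t => X j (t j) with hY
  have hYmem : MemLp Y 2 (Measure.pi (uniformSubcube d p)) :=
    memLp_finsetSum' _ fun j _ => hmem' j
  have hYval : ∀ t, Y t = 1 / n * ∑ j, f (t j) := by
    intro t
    rw [hY, Finset.sum_apply, Finset.mul_sum]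
  have hmean : ∫ t, Y t ∂(Measure.pi (uniformSubcube d p)) = IntProblem d f := by
    have h1 : ∀ j, ∫ t : Fin (p ^ d) → Cube d, X j (t j) ∂(Measure.pi (uniformSubcube d p)) =
        1 / n * ∫ x, f x ∂(uniformSubcube d p j) := by
      intro j
      rw [← integral_const_mul]
      exact integral_comp_eval (hmem j).aestronglyMeasurable
    simp only [hY, Finset.sum_apply]
    rw [integral_finsetSum _ fun j _ => (hmem' j).integrable (by norm_num)]
    simp only [h1]
    rw [← Finset.mul_sum, integral_uniformSubcube_sum hp, ← hn]
    field_simp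
  have hvar : ENNReal.ofReal Var[Y; Measure.pi (uniformSubcube d p)] =
      ∫⁻ t, ‖IntProblem d f - (haberMethod d p).approx f t‖ₑ ^ 2 ∂(haberMethod d p).P := by
    rw [hYmem.ofReal_variance_eq, evariance, hmean]
    refine lintegral_congr fun t => ?_
    rw [approx_haberMethod p f t, ← hn, ← hYval, enorm_sub_rev]
  rw [← hvar, hY, variance_sum_pi hmem]
  simp only [← ofReal_variance_eq_lintegral_prod]
  have h2 : ∀ j, 0 ≤ 2 * Var[f; uniformSubcube d p j] := fun j =>
    mul_nonneg two_pos.le (variance_nonneg _ _)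
  rw [← ENNReal.ofReal_sum_of_nonneg fun j _ => h2 j, ← ENNReal.ofReal_mul (by positivity),
    Finset.mul_sum]
  congr 1
  refine Finset.sum_congr rfl fun j _ => ?_
  rw [hX, variance_const_mul]
  field_simp

theorem rpow_int_exponent (hd : 0 < d) (p : ℕ) :
    ((p ^ d : ℕ) : ℝ) ^ (1 / 2 + 1 / (2 * (d : ℝ))) = √((p : ℝ) ^ (d + 1)) := by
  have hd' : (0 : ℝ) < d := by exact_mod_cast hd
  have hp' : (0 : ℝ) ≤ p := Nat.cast_nonneg p
  rw [Real.sqrt_eq_rpow, Nat.cast_pow, ← Real.rpow_natCast, ← Real.rpow_natCast,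
    ← Real.rpow_mul hp', ← Real.rpow_mul hp']
  congr 1
  push_cast
  field_simp

theorem rpow_app_exponent (hd : 0 < d) (p : ℕ) :
    ((p ^ d : ℕ) : ℝ) ^ (1 / (2 * (d : ℝ))) = √((p : ℝ) ^ 1) := by
  have hd' : (0 : ℝ) < d := by exact_mod_cast hd
  have hp' : (0 : ℝ) ≤ p := Nat.cast_nonneg p
  rw [Real.sqrt_eq_rpow, Nat.cast_pow, ← Real.rpow_natCast, ← Real.rpow_mul hp', pow_one]
  congr 1
  field_simp

theorem IsIsotropicWiener.avgError_haberMethod (hd : 0 < d) {μ : Measure C(Cube d, ℝ)}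
    (hμ : IsIsotropicWiener μ) {p : ℕ} (hp : 0 < p) :
    (haberMethod d p).avgError (IntProblem d) μ =
      ENNReal.ofReal (√(intConst d) /
        ((p ^ d : ℕ) : ℝ) ^ (1 / 2 + 1 / (2 * (d : ℝ)))) := by
  have := isProbabilityMeasure_of_isIsotropicWiener hμ
  have hp' : (0 : ℝ) < p := by exact_mod_cast hp
  have hd' : (0 : ℝ) < d := by exact_mod_cast hd
  have hI : 0 ≤ intConst d :=
    integral_nonneg fun y => integral_nonneg fun x => by positivity
  have hswap : ∀ j : Fin (p ^ d), ∫⁻ f : C(Cube d, ℝ), ∫⁻ z : Cube d × Cube d,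
      ‖f z.1 - f z.2‖ₑ ^ 2 ∂((uniformSubcube d p j).prod (uniformSubcube d p j)) ∂μ =
      ENNReal.ofReal (2 * intConst d / p) := by
    intro j
    rw [lintegral_lintegral_swap]
    · simp only [hμ.lintegral_increment_sq]
      exact lintegral_prod_uniformSubcube hp j
    · have : Continuous fun q : C(Cube d, ℝ) × (Cube d × Cube d) =>
          ‖q.1 q.2.1 - q.1 q.2.2‖ₑ ^ 2 := by fun_prop
      exact this.measurable.aemeasurable
  have hmeas : ∀ j : Fin (p ^ d), Measurable fun f : C(Cube d, ℝ) => ∫⁻ z : Cube d × Cube d,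
      ‖f z.1 - f z.2‖ₑ ^ 2 ∂((uniformSubcube d p j).prod (uniformSubcube d p j)) := by
    intro j
    have : Continuous fun q : C(Cube d, ℝ) × (Cube d × Cube d) =>
        ‖q.1 q.2.1 - q.1 q.2.2‖ₑ ^ 2 := by fun_prop
    exact this.measurable.lintegral_prod_right
  have hmain : ∫⁻ f, ∫⁻ t, ‖IntProblem d f - (haberMethod d p).approx f t‖ₑ ^ 2
      ∂(haberMethod d p).P ∂μ = ENNReal.ofReal (intConst d / ((p : ℝ) ^ d * p)) := by
    simp only [lintegral_haberMethod_error hp]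
    rw [lintegral_const_mul _ (Finset.measurable_fun_sum _ fun j _ => hmeas j),
      lintegral_finsetSum _ fun j _ => hmeas j]
    simp only [hswap, Finset.sum_const, Finset.card_univ, Fintype.card_fin, nsmul_eq_mul]
    rw [← ENNReal.ofReal_natCast, ← ENNReal.ofReal_mul (by positivity),
      ← ENNReal.ofReal_mul (by positivity)]
    congr 1
    push_cast
    field_simp
  rw [RandomizedMethod.avgError, hmain, ENNReal.ofReal_rpow_of_nonneg (by positivity) (by norm_num),
    ← Real.sqrt_eq_rpow, Real.sqrt_div hI, rpow_int_exponent hd, pow_succ]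

/-- For fixed `f`, the squared `L²` distance of `f` and its piecewise constant interpolant. -/
theorem enorm_appProblem_sub_sq {p : ℕ} (hp : 0 < p) (f : C(Cube d, ℝ)) :
    ‖AppProblem d f - ∑ j : Fin (p ^ d), f (center d p j) •
      indicatorConstLp 2 (measurableSet_subcube d p j)
        (measure_ne_top volume (subcube d p j)) (1 : ℝ)‖ₑ ^ 2 =
      ∑ j : Fin (p ^ d), ∫⁻ x in subcube d p j, ‖f x - f (center d p j)‖ₑ ^ 2 := by
  set g : Lp ℝ 2 (volume : Measure (Cube d)) := AppProblem d f -
    ∑ j : Fin (p ^ d), f (center d p j) • indicatorConstLp 2 (measurableSet_subcube d p j)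
        (measure_ne_top volume (subcube d p j)) (1 : ℝ) with hg
  have hdisj : ∀ᵐ x : Cube d, ∀ j k : Fin (p ^ d), j ≠ k →
      ¬ (x ∈ subcube d p j ∧ x ∈ subcube d p k) := by
    rw [ae_all_iff]
    intro j
    rw [ae_all_iff]
    intro k
    by_cases hjk : j = k
    · simp [hjk]
    · filter_upwards [measure_eq_zero_iff_ae_notMem.1 (volume_subcube_inter (d := d) hp hjk)]
        with x hx _
      exact hx
  have hind : ∀ᵐ x : Cube d, ∀ j : Fin (p ^ d),
      (f (center d p j) • indicatorConstLp 2 (measurableSet_subcube d p j)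
        (measure_ne_top volume (subcube d p j)) (1 : ℝ) :
          Lp ℝ 2 (volume : Measure (Cube d))) x =
        f (center d p j) * (subcube d p j).indicator (fun _ => (1 : ℝ)) x := by
    rw [ae_all_iff]
    intro j
    filter_upwards [Lp.coeFn_smul (f (center d p j)) (indicatorConstLp 2
        (measurableSet_subcube d p j) (measure_ne_top volume (subcube d p j)) (1 : ℝ)),
      indicatorConstLp_coeFn (p := 2) (hs := measurableSet_subcube d p j)
        (hμs := measure_ne_top volume (subcube d p j)) (c := (1 : ℝ))] with x h1 h2
    rw [h1, Pi.smul_apply, h2, smul_eq_mul]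
  have hgval : ∀ᵐ x : Cube d, ∀ k, x ∈ subcube d p k → g x = f x - f (center d p k) := by
    have hsum := Lp.coeFn_finsetSum (Finset.univ : Finset (Fin (p ^ d))) fun j =>
      (f (center d p j) • indicatorConstLp 2 (measurableSet_subcube d p j)
        (measure_ne_top volume (subcube d p j)) (1 : ℝ) : Lp ℝ 2 (volume : Measure (Cube d)))
    filter_upwards [hdisj, hind, hsum, Lp.coeFn_sub (AppProblem d f) (∑ j : Fin (p ^ d),
        f (center d p j) • indicatorConstLp 2 (measurableSet_subcube d p j)
        (measure_ne_top volume (subcube d p j)) (1 : ℝ)),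
      ContinuousMap.coeFn_toLp (p := 2) (𝕜 := ℝ) volume f] with x h1 h2 h3 h4 h5 k hk
    rw [hg, h4, Pi.sub_apply, h3, Finset.sum_apply]
    simp only [h2]
    rw [Finset.sum_eq_single k, Set.indicator_of_mem hk, mul_one]
    · rw [AppProblem, h5]
    · intro j _ hjk
      rw [Set.indicator_of_notMem fun hj => h1 j k hjk ⟨hj, hk⟩, mul_zero]
    · simp
  have hnorm : ‖g‖ₑ ^ 2 = ∫⁻ x, ‖g x‖ₑ ^ 2 := by
    rw [Lp.enorm_def, eLpNorm_eq_lintegral_rpow_enorm_toReal (by norm_num) (by norm_num),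
      ← ENNReal.rpow_natCast, ← ENNReal.rpow_mul]
    norm_num
  rw [hnorm, lintegral_eq_sum_subcube hp]
  refine Finset.sum_congr rfl fun j _ => ?_
  refine setLIntegral_congr_fun_ae (measurableSet_subcube d p j) ?_
  filter_upwards [hgval] with x hx hxj
  rw [hx j hxj]

theorem IsIsotropicWiener.avgError_piecewiseConstMethod (hd : 0 < d) {μ : Measure C(Cube d, ℝ)}
    (hμ : IsIsotropicWiener μ) {p : ℕ} (hp : 0 < p) :
    (piecewiseConstMethod d p).avgError (AppProblem d) μ =
      ENNReal.ofReal (√(appConst d) / ((p ^ d : ℕ) : ℝ) ^ (1 / (2 * (d : ℝ)))) := by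
  have := isProbabilityMeasure_of_isIsotropicWiener hμ
  have hp' : (0 : ℝ) < p := by exact_mod_cast hp
  have hd' : (0 : ℝ) < d := by exact_mod_cast hd
  have hI : 0 ≤ appConst d := integral_nonneg fun x => by positivity
  have hcont : ∀ j : Fin (p ^ d), Continuous fun q : C(Cube d, ℝ) × Cube d =>
      ‖q.1 q.2 - q.1 (center d p j)‖ₑ ^ 2 := fun j => by fun_prop
  have hswap : ∀ j : Fin (p ^ d), ∫⁻ f : C(Cube d, ℝ), (∫⁻ x in subcube d p j,
      ‖f x - f (center d p j)‖ₑ ^ 2) ∂μ =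
      ENNReal.ofReal (((p : ℝ) ^ d)⁻¹) * ENNReal.ofReal (appConst d / p) := by
    intro j
    rw [lintegral_lintegral_swap (hcont j).measurable.aemeasurable]
    simp only [hμ.lintegral_increment_sq]
    rw [restrict_subcube_eq hp, lintegral_smul_measure, smul_eq_mul,
      lintegral_map (by fun_prop) (measurable_subcubeMap p j)]
    congr 1
    simp only [← subcubeMap_cubeCenter, norm_subcubeMap_sub]
    rw [div_eq_mul_inv, ENNReal.ofReal_mul hI, ← lintegral_norm_sub_cubeCenter,
      ← lintegral_mul_const _ (by fun_prop)]
    refine lintegral_congr fun x => ?_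
    rw [← ENNReal.ofReal_mul (norm_nonneg _), div_eq_mul_inv]
  have hmain : ∫⁻ f, ∫⁻ t, ‖AppProblem d f - (piecewiseConstMethod d p).approx f t‖ₑ ^ 2
      ∂(piecewiseConstMethod d p).P ∂μ = ENNReal.ofReal (appConst d / p) := by
    have h1 : ∀ f, ∫⁻ t, ‖AppProblem d f - (piecewiseConstMethod d p).approx f t‖ₑ ^ 2
        ∂(piecewiseConstMethod d p).P =
        ∑ j : Fin (p ^ d), ∫⁻ x in subcube d p j, ‖f x - f (center d p j)‖ₑ ^ 2 := by
      intro f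
      have h2 : ∀ t, ‖AppProblem d f - (piecewiseConstMethod d p).approx f t‖ₑ ^ 2 =
          ∑ j : Fin (p ^ d), ∫⁻ x in subcube d p j, ‖f x - f (center d p j)‖ₑ ^ 2 := fun t => by
        rw [approx_piecewiseConstMethod p f t, enorm_appProblem_sub_sq hp]
      simp only [h2, lintegral_const, measure_univ, mul_one]
    simp only [h1]
    rw [lintegral_finsetSum _ fun j _ => (hcont j).measurable.lintegral_prod_right]
    simp only [hswap, Finset.sum_const, Finset.card_univ, Fintype.card_fin, nsmul_eq_mul]
    rw [← mul_assoc, ← ENNReal.ofReal_natCast, ← ENNReal.ofReal_mul (by positivity), Nat.cast_pow,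
      mul_inv_cancel₀ (by positivity), ENNReal.ofReal_one, one_mul]
  rw [RandomizedMethod.avgError, hmain, ENNReal.ofReal_rpow_of_nonneg (by positivity) (by norm_num),
    ← Real.sqrt_eq_rpow, Real.sqrt_div hI, rpow_app_exponent hd, pow_one]

end Methods

/-! ### Optimality -/

section Optimality

variable {d : ℕ}

theorem exists_le_integral_norm_sub (hd : 0 < d) :
    ∃ c : ℝ, 0 < c ∧ ∀ y : EuclideanSpace ℝ (Fin d),
      c ≤ ∫ x : Cube d, ‖(x : EuclideanSpace ℝ (Fin d)) - y‖ / 2 := by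
  set V : ℝ := volume.real (Metric.ball (0 : EuclideanSpace ℝ (Fin d)) 1) with hV
  have hV0 : 0 < V := ENNReal.toReal_pos (Metric.measure_ball_pos _ _ one_pos).ne'
    measure_ball_lt_top.ne
  have h2 : 1 < 2 ^ d := Nat.one_lt_two_pow hd.ne'
  refine ⟨1 / 16 * ((1 / (24 * ((2 : ℕ) : ℝ))) ^ d * V), by positivity, fun y => ?_⟩
  have key : ∀ j : Fin (2 ^ d),
      1 / 4 ≤ ‖((center d 2 j : Cube d) : EuclideanSpace ℝ (Fin d)) - y‖ →
      1 / 16 * ((1 / (24 * ((2 : ℕ) : ℝ))) ^ d * V) ≤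
        ∫ x : Cube d, ‖(x : EuclideanSpace ℝ (Fin d)) - y‖ / 2 := by
    intro j hj
    rw [← measureReal_near_center two_pos j]
    refine mul_measureReal_le_integral_cube (by fun_prop) (fun x => by positivity)
      (measurableSet_lt (by fun_prop) measurable_const) fun x hx => ?_
    have h3 : ‖(x : EuclideanSpace ℝ (Fin d)) - center d 2 j‖ < 1 / (24 * ((2 : ℕ) : ℝ)) := hx
    have h4 := norm_sub_le_norm_sub_add_norm_sub (center d 2 j : EuclideanSpace ℝ (Fin d)) x y
    rw [norm_sub_rev (center d 2 j : EuclideanSpace ℝ (Fin d)) x] at h4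
    norm_num at h3
    linarith
  -- the centres of two different subcubes cannot both be close to `y`
  by_cases hy : 1 / 4 ≤ ‖((center d 2 ⟨0, by omega⟩ : Cube d) : EuclideanSpace ℝ (Fin d)) - y‖
  · exact key _ hy
  · refine key ⟨1, h2⟩ ?_
    have h5 := le_norm_center_sub (d := d) (p := 2) (j := ⟨0, by omega⟩) (k := ⟨1, h2⟩) (by simp)
    have h6 := norm_sub_le_norm_sub_add_norm_sub
      (center d 2 ⟨0, by omega⟩ : EuclideanSpace ℝ (Fin d)) y
      (center d 2 ⟨1, h2⟩ : EuclideanSpace ℝ (Fin d))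
    rw [norm_sub_rev y] at h6
    push Not at hy
    rw [Nat.cast_ofNat] at h5
    linarith

theorem appConst_pos (hd : 0 < d) : 0 < appConst d := by
  obtain ⟨c, hc, h⟩ := exists_le_integral_norm_sub hd
  have := h 0
  simp only [sub_zero] at this
  exact hc.trans_le this

theorem intConst_pos (hd : 0 < d) : 0 < intConst d := by
  obtain ⟨c, hc, h⟩ := exists_le_integral_norm_sub hd
  have hcont : Continuous fun z : Cube d × Cube d =>
      ‖(z.2 : EuclideanSpace ℝ (Fin d)) - z.1‖ / 2 := by fun_prop
  have hint : Integrable (fun z : Cube d × Cube d =>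
      ‖(z.2 : EuclideanSpace ℝ (Fin d)) - z.1‖ / 2) (volume.prod volume) :=
    hcont.integrable_of_hasCompactSupport (HasCompactSupport.of_compactSpace _)
  calc 0 < c := hc
    _ = ∫ _ : Cube d, c := by simp
    _ ≤ intConst d := integral_mono (integrable_const c) hint.integral_prod_left fun y => h y

/-- The choice `p = ⌈(ε ^ (-2) * I) ^ (1 / a)⌉` of the number of subdivisions makes
`√I / p ^ (a / 2)` at most `ε`, and it is of order `ε ^ (-2 / a)`. -/
theorem ceil_rpow_bounds {I : ℝ} (hI : 0 < I) {a : ℕ} (ha : 0 < a) {ε : ℝ} (hε : 0 < ε) :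
    0 < ⌈(ε ^ (-2 : ℤ) * I) ^ (1 / (a : ℝ))⌉₊ ∧
    √I / √((⌈(ε ^ (-2 : ℤ) * I) ^ (1 / (a : ℝ))⌉₊ : ℝ) ^ a) ≤ ε ∧
    (ε ≤ √I → (⌈(ε ^ (-2 : ℤ) * I) ^ (1 / (a : ℝ))⌉₊ : ℝ) ^ d ≤
      2 ^ d * I ^ ((d : ℝ) / a) * ε ^ (-2 * (d : ℝ) / a)) := by
  have ha' : (0 : ℝ) < a := by exact_mod_cast ha
  have hz : ε ^ (-2 : ℤ) = (ε ^ 2)⁻¹ := by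
    rw [zpow_neg]
    norm_cast
  rw [hz]
  set X : ℝ := ((ε ^ 2)⁻¹ * I) ^ (1 / (a : ℝ)) with hX
  have hX0 : 0 < X := by positivity
  have hXa : X ^ a = (ε ^ 2)⁻¹ * I := by
    rw [hX, ← Real.rpow_natCast, ← Real.rpow_mul (by positivity), one_div_mul_cancel ha'.ne',
      Real.rpow_one]
  have hp0 : 0 < ⌈X⌉₊ := Nat.ceil_pos.2 hX0
  refine ⟨hp0, ?_, fun hεI => ?_⟩
  · have hp' : (0 : ℝ) < ⌈X⌉₊ := by exact_mod_cast hp0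
    rw [← Real.sqrt_div hI.le]
    refine Real.sqrt_le_iff.2 ⟨hε.le, ?_⟩
    rw [div_le_iff₀ (by positivity)]
    have h1 : X ^ a ≤ (⌈X⌉₊ : ℝ) ^ a := pow_le_pow_left₀ hX0.le (Nat.le_ceil X) a
    rw [hXa] at h1
    calc I = ε ^ 2 * ((ε ^ 2)⁻¹ * I) := by field_simp
      _ ≤ ε ^ 2 * (⌈X⌉₊ : ℝ) ^ a := by gcongr
  · have hX1 : 1 ≤ X := by
      refine Real.one_le_rpow ?_ (by positivity)
      rw [inv_mul_eq_div, le_div_iff₀ (by positivity), one_mul, ← Real.sq_sqrt hI.le]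
      gcongr
    have h1 : (⌈X⌉₊ : ℝ) ≤ 2 * X := by
      have := Nat.ceil_lt_add_one hX0.le
      linarith
    refine (pow_le_pow_left₀ (Nat.cast_nonneg _) h1 d).trans (le_of_eq ?_)
    have h2 : X ^ d = I ^ ((d : ℝ) / a) * ε ^ (-2 * (d : ℝ) / a) := by
      rw [hX, ← Real.rpow_natCast, ← Real.rpow_mul (by positivity), one_div_mul_eq_div,
        Real.mul_rpow (by positivity) hI.le, Real.inv_rpow (by positivity),
        ← Real.rpow_natCast ε 2, ← Real.rpow_mul hε.le, ← Real.rpow_neg hε.le, mul_comm]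
      congr 2
      push_cast
      ring
    rw [mul_pow, h2, mul_assoc]

theorem RandomizedMethod.avgComplexity_le {G : Type*} [NormedAddCommGroup G]
    {A : RandomizedMethod d G} {S : C(Cube d, ℝ) → G} {μ : Measure C(Cube d, ℝ)} {ε : ℝ}
    (hA : A.IsAdmissible S μ) (hε : A.avgError S μ ≤ ENNReal.ofReal ε) :
    avgComplexity ε S μ ≤ A.avgCost μ :=
  iInf₂_le A ⟨hA, hε⟩

theorem isTheta_of_sandwich {cost comp : ℝ → ℝ≥0∞} {e : ℝ → ℝ} {c C : ℝ} (hc : 0 < c)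
    (he : ∀ ε, 0 < ε → 0 ≤ e ε) (hcost : ∀ ε, cost ε ≠ ∞) (hle : ∀ ε, 0 < ε → comp ε ≤ cost ε)
    (hlow : ∀ᶠ ε in 𝓝[>] (0 : ℝ), ENNReal.ofReal (c * e ε) ≤ comp ε)
    (hupp : ∀ᶠ ε in 𝓝[>] (0 : ℝ), (cost ε).toReal ≤ C * e ε) :
    (fun ε => (cost ε).toReal) =Θ[𝓝[>] 0] (fun ε => (comp ε).toReal) ∧
      (fun ε => (cost ε).toReal) =Θ[𝓝[>] 0] e := by
  have h1 : ∀ᶠ ε in 𝓝[>] (0 : ℝ), c * e ε ≤ (comp ε).toReal ∧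
      (comp ε).toReal ≤ (cost ε).toReal ∧ (cost ε).toReal ≤ C * e ε ∧ 0 ≤ e ε := by
    filter_upwards [hlow, hupp, self_mem_nhdsWithin] with ε h2 h3 h4
    have h5 := hle ε h4
    have h6 : comp ε ≠ ∞ := ne_top_of_le_ne_top (hcost ε) h5
    exact ⟨(ENNReal.ofReal_le_iff_le_toReal h6).1 h2, ENNReal.toReal_mono (hcost ε) h5, h3,
      he ε h4⟩
  refine ⟨⟨IsBigO.of_bound (C / c) ?_, IsBigO.of_bound 1 ?_⟩,
    ⟨IsBigO.of_bound C ?_, IsBigO.of_bound c⁻¹ ?_⟩⟩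
  all_goals
    filter_upwards [h1] with ε ⟨h2, h3, h4, h5⟩
    simp only [Real.norm_eq_abs, abs_of_nonneg ENNReal.toReal_nonneg, abs_of_nonneg h5]
  · have hC : 0 ≤ C * e ε := ENNReal.toReal_nonneg.trans h4
    rcases h5.eq_or_lt with h0 | h0
    · rw [← h0, mul_zero] at h4
      have h6 : (comp ε).toReal = 0 := le_antisymm (h3.trans h4) ENNReal.toReal_nonneg
      rw [h6, mul_zero]
      exact h4
    · have hC0 : 0 ≤ C := nonneg_of_mul_nonneg_left hC h0
      calc (cost ε).toReal ≤ C * e ε := h4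
        _ = C / c * (c * e ε) := by field_simp
        _ ≤ C / c * (comp ε).toReal := by gcongr
  · rw [one_mul]
    exact h3
  · exact h4
  · rw [inv_mul_eq_div, le_div_iff₀ hc, mul_comm]
    exact h2.trans h3

end Optimality

theorem theorem2 (d : ℕ) (hd : 0 < d) (μ : Measure C(Cube d, ℝ)) (hμ : IsIsotropicWiener μ) :
    -- cost and average error of both methods for every `n = p ^ d`
    (∀ p : ℕ, 0 < p →
      (haberMethod d p).IsAdmissible (IntProblem d) μ ∧
      (haberMethod d p).avgCost μ = ((p ^ d : ℕ) : ℝ≥0∞) ∧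
      (haberMethod d p).avgError (IntProblem d) μ =
        ENNReal.ofReal (√(intConst d) / ((p ^ d : ℕ) : ℝ) ^ (1 / 2 + 1 / (2 * (d : ℝ)))) ∧
      (piecewiseConstMethod d p).IsAdmissible (AppProblem d) μ ∧
      (piecewiseConstMethod d p).avgCost μ = ((p ^ d : ℕ) : ℝ≥0∞) ∧
      (piecewiseConstMethod d p).avgError (AppProblem d) μ =
        ENNReal.ofReal (√(appConst d) / ((p ^ d : ℕ) : ℝ) ^ (1 / (2 * (d : ℝ))))) ∧
    -- the error is at most `ε` for the choices `n = (pInt d ε) ^ d` and `n = (pApp d ε) ^ d`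
    (∀ ε : ℝ, 0 < ε →
      0 < pInt d ε ∧
      (haberMethod d (pInt d ε)).avgError (IntProblem d) μ ≤ ENNReal.ofReal ε ∧
      0 < pApp d ε ∧
      (piecewiseConstMethod d (pApp d ε)).avgError (AppProblem d) μ ≤ ENNReal.ofReal ε) ∧
    -- integration: the cost is proportional to the complexity, which is `Θ(ε ^ (-2 / (1 + 1 / d)))`
    ((∀ ε : ℝ, 0 < ε → avgComplexity ε (IntProblem d) μ ≠ ∞) ∧
      (fun ε : ℝ => ((haberMethod d (pInt d ε)).avgCost μ).toReal) =Θ[𝓝[>] 0]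
        (fun ε : ℝ => (avgComplexity ε (IntProblem d) μ).toReal) ∧
      (fun ε : ℝ => ((haberMethod d (pInt d ε)).avgCost μ).toReal) =Θ[𝓝[>] 0]
        (fun ε : ℝ => ε ^ (-2 / (1 + 1 / (d : ℝ))))) ∧
    -- approximation: the cost is proportional to the complexity, which is `Θ(ε ^ (-2 * d))`
    ((∀ ε : ℝ, 0 < ε → avgComplexity ε (AppProblem d) μ ≠ ∞) ∧
      (fun ε : ℝ => ((piecewiseConstMethod d (pApp d ε)).avgCost μ).toReal) =Θ[𝓝[>] 0]
        (fun ε : ℝ => (avgComplexity ε (AppProblem d) μ).toReal) ∧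
      (fun ε : ℝ => ((piecewiseConstMethod d (pApp d ε)).avgCost μ).toReal) =Θ[𝓝[>] 0]
        (fun ε : ℝ => ε ^ (-2 * (d : ℝ)))) := by
  have := isProbabilityMeasure_of_isIsotropicWiener hμ
  have hd' : (0 : ℝ) < d := by exact_mod_cast hd
  have hI := intConst_pos hd
  have hJ := appConst_pos hd
  have hpInt : ∀ ε : ℝ,
      pInt d ε = ⌈(ε ^ (-2 : ℤ) * intConst d) ^ (1 / ((d + 1 : ℕ) : ℝ))⌉₊ := by
    intro ε
    rw [pInt, Nat.cast_succ]
  have hpApp : ∀ ε : ℝ,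
      pApp d ε = ⌈(ε ^ (-2 : ℤ) * appConst d) ^ (1 / ((1 : ℕ) : ℝ))⌉₊ := by
    intro ε
    rw [pApp, Nat.cast_one, div_one, Real.rpow_one]
  have hInt : ∀ ε : ℝ, 0 < ε → 0 < pInt d ε ∧
      (haberMethod d (pInt d ε)).avgError (IntProblem d) μ ≤ ENNReal.ofReal ε ∧
      (ε ≤ √(intConst d) → (pInt d ε : ℝ) ^ d ≤ 2 ^ d * intConst d ^ ((d : ℝ) / (d + 1 : ℕ)) *
        ε ^ (-2 * (d : ℝ) / (d + 1 : ℕ))) := by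
    intro ε hε
    obtain ⟨h1, h2, h3⟩ := ceil_rpow_bounds (d := d) hI d.succ_pos hε
    rw [← hpInt] at h1 h2 h3
    refine ⟨h1, ?_, h3⟩
    rw [hμ.avgError_haberMethod hd h1, rpow_int_exponent hd]
    exact ENNReal.ofReal_le_ofReal h2
  have hApp : ∀ ε : ℝ, 0 < ε → 0 < pApp d ε ∧
      (piecewiseConstMethod d (pApp d ε)).avgError (AppProblem d) μ ≤ ENNReal.ofReal ε ∧
      (ε ≤ √(appConst d) → (pApp d ε : ℝ) ^ d ≤ 2 ^ d * appConst d ^ ((d : ℝ) / (1 : ℕ)) *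
        ε ^ (-2 * (d : ℝ) / (1 : ℕ))) := by
    intro ε hε
    obtain ⟨h1, h2, h3⟩ := ceil_rpow_bounds (d := d) hJ one_pos hε
    rw [← hpApp] at h1 h2 h3
    refine ⟨h1, ?_, h3⟩
    rw [hμ.avgError_piecewiseConstMethod hd h1, rpow_app_exponent hd]
    exact ENNReal.ofReal_le_ofReal h2
  have hcompInt : ∀ ε : ℝ, 0 < ε → avgComplexity ε (IntProblem d) μ ≤
      (haberMethod d (pInt d ε)).avgCost μ := fun ε hε =>
    RandomizedMethod.avgComplexity_le (isAdmissible_haberMethod _ μ) (hInt ε hε).2.1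
  have hcompApp : ∀ ε : ℝ, 0 < ε → avgComplexity ε (AppProblem d) μ ≤
      (piecewiseConstMethod d (pApp d ε)).avgCost μ := fun ε hε =>
    RandomizedMethod.avgComplexity_le (isAdmissible_piecewiseConstMethod _ μ) (hApp ε hε).2.1
  have hcostInt : ∀ ε : ℝ, (haberMethod d (pInt d ε)).avgCost μ ≠ ∞ := fun ε => by
    rw [avgCost_haberMethod]
    exact ENNReal.natCast_ne_top _
  have hcostApp : ∀ ε : ℝ, (piecewiseConstMethod d (pApp d ε)).avgCost μ ≠ ∞ := fun ε => by
    rw [avgCost_piecewiseConstMethod]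
    exact ENNReal.natCast_ne_top _
  have hsmall : ∀ {I : ℝ}, 0 < I → ∀ᶠ ε in 𝓝[>] (0 : ℝ), ε ≤ √I := fun hI =>
    nhdsWithin_le_nhds (eventually_le_nhds (Real.sqrt_pos.2 hI))
  refine ⟨fun p hp => ⟨isAdmissible_haberMethod p μ, avgCost_haberMethod p μ,
    hμ.avgError_haberMethod hd hp, isAdmissible_piecewiseConstMethod p μ,
    avgCost_piecewiseConstMethod p μ, hμ.avgError_piecewiseConstMethod hd hp⟩,
    fun ε hε => ⟨(hInt ε hε).1, (hInt ε hε).2.1, (hApp ε hε).1, (hApp ε hε).2.1⟩,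
    ⟨fun ε hε => ne_top_of_le_ne_top (hcostInt ε) (hcompInt ε hε), ?_⟩,
    ⟨fun ε hε => ne_top_of_le_ne_top (hcostApp ε) (hcompApp ε hε), ?_⟩⟩
  · obtain ⟨c, hc, hlow⟩ := hμ.exists_le_avgComplexity_int hd
    refine isTheta_of_sandwich (C := 2 ^ d * intConst d ^ ((d : ℝ) / (d + 1 : ℕ))) hc
      (fun ε hε => Real.rpow_nonneg hε.le _) hcostInt hcompInt hlow ?_
    filter_upwards [hsmall hI, self_mem_nhdsWithin] with ε h1 h2
    have h3 := (hInt ε h2).2.2 h1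
    have hexp : -2 / (1 + 1 / (d : ℝ)) = -2 * (d : ℝ) / (d + 1 : ℕ) := by
      push_cast
      field_simp
    rw [avgCost_haberMethod, ENNReal.toReal_natCast, hexp]
    exact_mod_cast h3
  · obtain ⟨c, hc, hlow⟩ := hμ.exists_le_avgComplexity_app hd
    refine isTheta_of_sandwich (C := 2 ^ d * appConst d ^ ((d : ℝ) / (1 : ℕ))) hc
      (fun ε hε => Real.rpow_nonneg hε.le _) hcostApp hcompApp hlow ?_
    filter_upwards [hsmall hJ, self_mem_nhdsWithin] with ε h1 h2
    have h3 := (hApp ε h2).2.2 h1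
    rw [Nat.cast_one, div_one, div_one] at h3
    rw [avgCost_piecewiseConstMethod, ENNReal.toReal_natCast, Nat.cast_one, div_one]
    exact_mod_cast h3
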